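/- **Setting.** Let $\Omega$ be a compact space with a $\mathbb Z^2$-action $T=(T_1,T_2)$ by homeomorphisms and let $\mathbf P$ be an invariant and ergodic Borel probability measure on $\Omega$. Let $B_+,B_-\in\mathbb R$ and let $S_1^{\pm},S_2^{\pm}$ be magnetic translations on $\ell^2(\mathbb Z^2)$, in any gauge, i.e. $(S_j^\pm\psi)(n)=u_j^\pm(n)\psi(n-e_j)$ with $|u_j^\pm(n)|=1$ and $S_1^\pm S_2^\pm=e^{\imath B_\pm}S_2^\pm S_1^\pm$. Let $H_\pm=(H_{\pm,\omega})_{\omega\in\Omega}$ be families of self-adjoint operators on $\ell^2(\mathbb Z^2)$, with matrix elements measurable in $\omega$ and norms bounded uniformly in $\omega$, which are covariant, $(S_j^\pm)^*H_{\pm,\omega}S_j^\pm=H_{\pm,T_j\omega}$ for $j=1,2$, and short ranged: $\langle n|H_{\pm,\omega}|m\rangle=0$ for $|n-m|>R$, for some $R$ not depending on $\omega$. Let $\Delta\subset\mathbb R$ be an open interval containing the Fermi level $E_F$ and such that $\Delta\cap\sigma(H_{+,\omega})=\Delta\cap\sigma(H_{-,\omega})=\emptyset$ for $\mathbf P$-almost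 every $\omega$. Let $\Pi_\pm:\ell^2(\mathbb Z^2)\to\ell^2(\mathbb Z\times\mathbb Z_\pm)$ be the restrictions, $\mathbb Z_+=\mathbb Z\cap[0,\infty)$, $\mathbb Z_-=\mathbb Z\cap(-\infty,0)$, and set $\widehat H_{\pm,\omega}=\Pi_\pm H_{\pm,\omega}\Pi_\pm^*$. Let $\widehat S_1$ be the translation $\psi(n)\mapsto u(n)\psi(n-e_1)$ with $u=u_1^+$ for $n_2\ge0$ and $u=u_1^-$ for $n_2<0$ (the plain shift if $u_1^\pm=1$), and call a family $A=(A_\omega)$ covariant in the $1$-direction if $\widehat S_1^*A_\omega\widehat S_1=A_{T_1\omega}$. Let $K=(K_\omega)$ be a family of self-adjoint operators on $\ell^2(\mathbb Z^2)$, with measurable matrix elements and uniformly bounded norms, covariant in the $1$-direction, supported on a strip ($\langle n|K_\omega|m\rangle=0$ if $|n_2|>N$ or $|m_2|>N$) and of finite range ($\langle n|K_\omega|m\rangle=0$ if $|n-m|>R'$), with $N,R'$ not depending on $\omega$. Put $$H_\omega=\widehat H_{+,\omega}\oplus\widehat H_{-,\omega}+K_\omega .$$ **Proposition.** Let $g:\mathbb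 R\to\mathbb C$ be smooth and vanish outside $\Delta$. Then: 1. For all $\alpha>0$ there is a constant $C$ such that for $\mathbf P$-almost every $\omega$, and in fact for every $\omega\in\Omega$ with $\Delta\cap\sigma(H_{+,\omega})=\Delta\cap\sigma(H_{-,\omega})=\emptyset$, $$|\langle n|g(H_\omega)|m\rangle|\;\le\;\frac{C}{1+|n_2|^\alpha+|m_2|^\alpha+|n_1-m_1|^\alpha}\qquad\text{for all } n,m\in\mathbb Z^2 .$$ If the matrix elements of $H_{\pm,\omega}$ depend continuously on $\omega$ and $\mathbf P$ has full support, then the bound holds for every $\omega\in\Omega$. 2. The family $g(H)=(g(H_\omega))_{\omega\in\Omega}$ is $\widehat{\mathcal T}$-trace class, where $\widehat{\mathcal T}(A)=\int\mathbf P(d\omega)\sum_{n_2\in\mathbb Z}\langle 0,n_2|A_\omega|0,n_2\rangle$. That is: $g(H)$ is covariant in the $1$-direction, bounded and measurable; it is a limit, in the norm $\operatorname{ess\,sup}_\omega\|A_\omega\|$, of bounded measurable families $A$ that are covariant in the $1$-direction and satisfy, for some constant $c$, $\langle n|A_\omega|m\rangle=0$ whenever $|n_2|\ge c$, $|m_2|\ge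 c$ or $|n_1-m_1|\ge c$; and $\widehat{\mathcal T}(|g(H)|)<\infty$. Also $\widehat{\mathcal T}(g(H))$ itself exists: the series converges absolutely almost surely and has an integrable sum. -/

import Mathlib

open MeasureTheory Filter Topology

noncomputable section

namespace Interface

/-- The Hilbert space `ℓ²(ι)` of square summable complex functions on `ι`. -/
abbrev Ell2 (ι : Type) : Type := lp (fun _ : ι => ℂ) 2

/-- The lattice `ℤ²`; `n.1 = n₁` runs along the interface, `n.2 = n₂` transversally to it. -/
abbrev Lattice : Type := ℤ × ℤ

/-- Bounded linear operators on `ℓ²(ℤ²)`. -/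
abbrev Op : Type := Ell2 Lattice →L[ℂ] Ell2 Lattice

lemma sum_pull_le {ι κ : Type} (f : ι ↪ κ) (u : ι → Circle) (ψ : Ell2 κ) (s : Finset ι) :
    ∑ i ∈ s, ‖(u i : ℂ) * ψ (f i)‖ ^ (2 : ENNReal).toReal
      ≤ ‖ψ‖ ^ (2 : ENNReal).toReal := by
  have h := lp.sum_rpow_le_norm_rpow (p := 2) (by norm_num) ψ (s.map f)
  simpa [Circle.norm_coe] using h

/-- The weighted composition operator `(pull f u ψ)(i) = u(i) ψ(f(i))` from `ℓ²(κ)` to `ℓ²(ι)`,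
for an injective map `f : ι → κ` and phases `u(i)` of modulus one. -/
def pull {ι κ : Type} (f : ι ↪ κ) (u : ι → Circle) : Ell2 κ →L[ℂ] Ell2 ι :=
  LinearMap.mkContinuous
    { toFun := fun ψ => ⟨fun i => (u i : ℂ) * ψ (f i), memℓp_gen' (sum_pull_le f u ψ)⟩
      map_add' := fun ψ φ => by
        ext i
        exact mul_add _ _ _
      map_smul' := fun c ψ => by
        ext i
        exact mul_left_comm _ _ _ }
    1 fun ψ => by
      rw [one_mul]
      exact lp.norm_le_of_forall_sum_le (by norm_num) (norm_nonneg _) (sum_pull_le f u ψ)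

lemma pull_apply {ι κ : Type} (f : ι ↪ κ) (u : ι → Circle) (ψ : Ell2 κ) (i : ι) :
    pull f u ψ i = (u i : ℂ) * ψ (f i) := rfl

/-- The absolute value `|A| = (A^* A)^{1/2}` of a bounded operator on a complex Hilbert space. -/
def opAbs {E : Type} [NormedAddCommGroup E] [InnerProductSpace ℂ E] [CompleteSpace E]
    (A : E →L[ℂ] E) : E →L[ℂ] E := CFC.abs A

/-- The set `Δ` of real energies does not meet the spectrum of `A`. -/
def IsGap (Δ : Set ℝ) (A : Op) : Prop := ∀ E ∈ Δ, (E : ℂ) ∉ spectrum ℂ A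

/-- The matrix element `⟨n|A|m⟩` of an operator on `ℓ²(ℤ²)`. -/
def matrixElement (A : Op) (n m : Lattice) : ℂ :=
  inner ℂ (lp.single 2 n (1 : ℂ) : Ell2 Lattice) (A (lp.single 2 m (1 : ℂ)))

/-- The two unit vectors `e₁ = (1,0)` and `e₂ = (0,1)` of `ℤ²`, indexed by `Fin 2`. -/
def unitVec : Fin 2 → Lattice := ![(1, 0), (0, 1)]

/-- Phases on the lattice for each of the two coordinate directions. -/
abbrev Phases : Type := Fin 2 → Lattice → Circle

/-- The translation by `unitVec j`, with phases: `(S_j ψ)(n) = u_j(n) ψ(n - e_j)`. -/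
def translation (u : Phases) (j : Fin 2) : Op :=
  pull (Equiv.subRight (unitVec j)).toEmbedding (u j)

/-- `u` is a gauge for the constant magnetic field `B`: the translations `S_1, S_2` with phases `u`
are magnetic translations, that is, `S_1 S_2 = e^{iB} S_2 S_1`. -/
def IsMagneticGauge (B : ℝ) (u : Phases) : Prop :=
  translation u 0 * translation u 1
    = Complex.exp (Complex.I * B) • (translation u 1 * translation u 0)

/-- The half spaces: `ℤ × [0,∞)` for `true` and `ℤ × (-∞,0)` for `false`. -/
def halfSpace : Bool → Set Lattice
  | true => {n | 0 ≤ n.2}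
  | false => {n | n.2 < 0}

/-- The partial isometry `Π_{2,±}` from `ℓ²(ℤ²)` onto `ℓ²` of a half space (restriction). -/
def halfRestrict (b : Bool) : Ell2 Lattice →L[ℂ] Ell2 (halfSpace b) :=
  pull (Function.Embedding.subtype _) 1

/-- The half-space restriction `Π H Π^*`. -/
def halfOp (b : Bool) (A : Op) : Ell2 (halfSpace b) →L[ℂ] Ell2 (halfSpace b) :=
  halfRestrict b ∘L A ∘L (halfRestrict b).adjoint

/-- The direct sum `A_+ ⊕ A_-` as an operator on `ℓ²(ℤ²)`. -/
def directSum (Ap : Ell2 (halfSpace true) →L[ℂ] Ell2 (halfSpace true))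
    (Am : Ell2 (halfSpace false) →L[ℂ] Ell2 (halfSpace false)) : Op :=
  (halfRestrict true).adjoint ∘L Ap ∘L halfRestrict true
    + (halfRestrict false).adjoint ∘L Am ∘L halfRestrict false

/-- The phases which agree with `up` on the upper and with `um` on the lower half space. The
translation `translation (joinPhases up um) 0` along the interface is thus the direct sum of
the magnetic translations of the two half spaces in the `1`-direction. -/
def joinPhases (up um : Phases) : Phases :=
  fun j n => if 0 ≤ n.2 then up j n else um j n

section Families

variable {Ω : Type*} [AddAction (ℤ × ℤ) Ω]

/-- Covariance in the direction `j`: `S_j^* A_ω S_j = A_{T_j ω}` for all `ω`. -/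
def IsCovariant (u : Phases) (j : Fin 2) (A : Ω → Op) : Prop :=
  ∀ ω, (translation u j).adjoint * A ω * translation u j = A (unitVec j +ᵥ ω)

/-- A family of operators with measurable matrix elements. -/
def IsMeasurableFamily {Ω : Type*} [MeasurableSpace Ω] (A : Ω → Op) : Prop :=
  ∀ n m, Measurable fun ω => matrixElement (A ω) n m

/-- A family of operators with uniformly bounded norms. -/
def IsBoundedFamily {Ω : Type*} (A : Ω → Op) : Prop :=
  ∃ M : ℝ, ∀ ω, ‖A ω‖ ≤ M

/-- A covariant family of short ranged Hamiltonians on `ℓ²(ℤ²)`. -/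
structure IsBulkFamily [MeasurableSpace Ω] (u : Phases) (H : Ω → Op) : Prop where
  selfAdjoint : ∀ ω, IsSelfAdjoint (H ω)
  measurable : IsMeasurableFamily H
  bounded : IsBoundedFamily H
  covariant : ∀ j, IsCovariant u j H
  shortRange : ∃ R : ℝ, ∀ ω n m, R < dist n m → matrixElement (H ω) n m = 0

/-- A coupling of two half spaces along the interface: supported on a strip `ℤ × [-N,N]`,
covariant in the `1`-direction and of finite hopping range. -/
structure IsCoupling [MeasurableSpace Ω] (u : Phases) (K : Ω → Op) : Prop where
  selfAdjoint : ∀ ω, IsSelfAdjoint (K ω)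
  measurable : IsMeasurableFamily K
  bounded : IsBoundedFamily K
  covariant : IsCovariant u 0 K
  strip : ∃ N : ℕ, ∀ ω (n m : Lattice), (N : ℤ) < |n.2| ∨ (N : ℤ) < |m.2| →
    matrixElement (K ω) n m = 0
  shortRange : ∃ R : ℝ, ∀ ω n m, R < dist n m → matrixElement (K ω) n m = 0

/-- The interface Hamiltonians `H_ω = Ĥ_{+,ω} ⊕ Ĥ_{-,ω} + K_ω`. -/
def interfaceHamiltonian {Ω : Type*} (Hp Hm K : Ω → Op) : Ω → Op :=
  fun ω => directSum (halfOp true (Hp ω)) (halfOp false (Hm ω)) + K ω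

/-- The gap condition: `E_F` lies in the open interval `Δ`, which almost surely does not meet the
spectra of `H_{±,ω}`. -/
structure GapCondition {Ω : Type*} [MeasurableSpace Ω] (P : Measure Ω) (Hp Hm : Ω → Op)
    (Δ : Set ℝ) (EF : ℝ) : Prop where
  isOpen : IsOpen Δ
  interval : Δ.OrdConnected
  fermi : EF ∈ Δ
  gap_plus : ∀ᵐ ω ∂P, IsGap Δ (Hp ω)
  gap_minus : ∀ᵐ ω ∂P, IsGap Δ (Hm ω)

/-- The operator `g(H)` of the continuous functional calculus, for a function `g : ℝ → ℂ` and
a bounded self-adjoint operator `H` (whose complex spectrum is real). -/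
def applyFun (g : ℝ → ℂ) (H : Op) : Op := cfc (fun z : ℂ => g z.re) H

/-- `|⟨n|A|m⟩| ≤ C / (1 + |n₂|^α + |m₂|^α + |n₁ - m₁|^α)` for all `n` and `m`. -/
def HasDecay (α C : ℝ) (A : Op) : Prop :=
  ∀ n m : Lattice, ‖matrixElement A n m‖ ≤
    C / (1 + |(n.2 : ℝ)| ^ α + |(m.2 : ℝ)| ^ α + |(n.1 : ℝ) - (m.1 : ℝ)| ^ α)

/-- The trace `∫ P(dω) ∑_{n₂} ⟨0,n₂|A_ω|0,n₂⟩` exists (the series converges absolutely, almost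
surely, and its sum is integrable) and has the value `t`. -/
def HasInterfaceTrace {Ω : Type*} [MeasurableSpace Ω] (P : Measure Ω) (A : Ω → Op) (t : ℂ) :
    Prop :=
  (∀ᵐ ω ∂P, Summable fun k : ℤ => matrixElement (A ω) (0, k) (0, k)) ∧
    Integrable (fun ω => ∑' k : ℤ, matrixElement (A ω) (0, k) (0, k)) P ∧
    ∫ ω, ∑' k : ℤ, matrixElement (A ω) (0, k) (0, k) ∂P = t

/-- The `*`-algebra of families which are covariant in the `1`-direction, of finite support in the
`2`-direction and of finite hopping distance in the `1`-direction. -/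
structure IsEdgeCore [MeasurableSpace Ω] (u : Phases) (A : Ω → Op) : Prop where
  measurable : IsMeasurableFamily A
  bounded : IsBoundedFamily A
  covariant : IsCovariant u 0 A
  support : ∃ C : ℤ, ∀ ω (n m : Lattice), C ≤ |n.2| ∨ C ≤ |m.2| ∨ C ≤ |n.1 - m.1| →
    matrixElement (A ω) n m = 0

/-- Elements of the edge algebra, the closure of the previous `*`-algebra with respect to the norm
`ess sup_ω ‖A_ω‖`. -/
structure IsEdgeElement [MeasurableSpace Ω] (P : Measure Ω) (u : Phases) (A : Ω → Op) :
    Prop where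
  measurable : IsMeasurableFamily A
  bounded : IsBoundedFamily A
  covariant : IsCovariant u 0 A
  approx : ∀ ε : ℝ, 0 < ε → ∃ A₀ : Ω → Op, IsEdgeCore u A₀ ∧ ∀ᵐ ω ∂P, ‖A ω - A₀ ω‖ ≤ ε

/-- Trace class families: elements `A` of the edge algebra for which `|A| = (A^* A)^{1/2}` has
finite trace; the trace of `A` itself exists as well. -/
structure IsInterfaceTraceClass [MeasurableSpace Ω] (P : Measure Ω) (u : Phases)
    (A : Ω → Op) : Prop where
  mem : IsEdgeElement P u A
  trace_abs : ∃ t : ℂ, HasInterfaceTrace P (fun ω => opAbs (A ω)) t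
  trace : ∃ t : ℂ, HasInterfaceTrace P A t

end Families

end Interface

end

/-! Since `g` vanishes outside the gap, `g(H_±) = 0`; away from the interface `H` acts like `H_+` or
`H_-`, so `g(H)` must be small there. Finite range makes this quantitative. A polynomial `q` of
degree `k` in an operator of range `r` moves a wave function by at most `k r`, so if `ψ` lives
farther than `L + k r` from the interface, then `q(H) ψ = q(H_±) ψ`. If moreover `|g - q| ≤ ε` on
`[-M, M]`, the spectral theorem gives `‖g(H) ψ‖ ≤ 2 ε ‖ψ‖` (`norm_applyFun_apply_le_of_agree`). As
`g` is smooth, `ε = O(k^{-p})` is possible for every `p` (`exists_polynomial_approx`), and the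
largest admissible `k` is proportional to the distance: this yields decay in `m₂`, and by normality
of `g(H)` in `n₂`. Decay in `n₁ - m₁` holds because `q(H)` has no matrix elements beyond distance `k
r` (`exists_decay`).

The same estimate shows that `q(H)` cut off to a strip approximates `g(H)` in norm, which puts
`g(H)` in the edge algebra (`IsInterfaceOf.norm_sub_proj_le`). For `|g(H)|` smoothness is lost, but
`‖|A| ψ‖ = ‖A ψ‖`, so the bounds on the columns of `g(H)` already make the trace converge. -/

noncomputable section

namespace Interface

/-! ### Jackson approximation by truncated Chebyshev series. -/

section PolynomialApproximation

open Real in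
/-- The Fourier coefficients of a smooth periodic function decay rapidly. -/
lemma exists_fourierCoeffOn_le (p : ℕ) (F : ℝ → ℂ) (hF : ContDiff ℝ (⊤ : ℕ∞) F)
    (hper : Function.Periodic F (2 * π)) :
    ∃ C : ℝ, ∀ n : ℤ, n ≠ 0 → ‖fourierCoeffOn two_pi_pos F n‖ ≤ C / |(n : ℝ)| ^ p := by
  induction p generalizing F with
  | zero =>
    obtain ⟨C, hC⟩ := isCompact_Icc.exists_bound_of_continuousOn
      (s := Set.Icc 0 (2 * π)) hF.continuous.continuousOn
    refine ⟨C, fun n _ => ?_⟩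
    rw [fourierCoeffOn_eq_integral, norm_smul, pow_zero, div_one, sub_zero]
    have h := intervalIntegral.norm_integral_le_of_norm_le_const (a := 0) (b := 2 * π) (C := C)
      (f := fun x => fourier (-n) (x : AddCircle (2 * π - 0)) • F x) (fun x hx => by
        rw [norm_smul]
        rw [Set.uIoc_of_le two_pi_pos.le] at hx
        rw [fourier_apply, Circle.norm_coe, one_mul]
        exact hC x ⟨hx.1.le, hx.2⟩)
    rw [sub_zero, abs_of_pos two_pi_pos] at h
    rw [norm_div, norm_one, norm_of_nonneg two_pi_pos.le, one_div, inv_mul_le_iff₀ two_pi_pos,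
      mul_comm (2 * π) C]
    simpa using h
  | succ p ih =>
    have hd : ContDiff ℝ (⊤ : ℕ∞) (deriv F) := hF.iterate_deriv 1
    have hdper : Function.Periodic (deriv F) (2 * π) := fun x => by
      rw [← deriv_comp_add_const]
      exact congrArg (fun f => deriv f x) (funext hper)
    obtain ⟨C, hC⟩ := ih (deriv F) hd hdper
    refine ⟨C, fun n hn => ?_⟩
    -- Integration by parts: the boundary term vanishes by periodicity, and each derivative gains a
    -- factor `1 / |n|`.
    rw [fourierCoeffOn_of_hasDerivAt two_pi_pos hn
      (fun x _ => (hF.differentiable (by simp) x).hasDerivAt) (hd.continuous.intervalIntegrable _ _)]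
    have h0 : F (2 * π) = F 0 := by simpa using hper 0
    have hn' : 0 < |(n : ℝ)| := by positivity
    rw [h0, sub_self, mul_zero, zero_sub, norm_mul, norm_neg, norm_mul]
    have h1 : ‖(1 : ℂ) / (-2 * π * Complex.I * n)‖ = 1 / (2 * π * |(n : ℝ)|) := by
      simp [abs_of_pos pi_pos]
    have h2 : ‖((2 * π : ℝ) : ℂ) - ((0 : ℝ) : ℂ)‖ = 2 * π := by
      simp [abs_of_pos pi_pos]
    rw [h1, h2, pow_succ]
    calc 1 / (2 * π * |(n : ℝ)|) * (2 * π * ‖fourierCoeffOn two_pi_pos (deriv F) n‖)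
        = ‖fourierCoeffOn two_pi_pos (deriv F) n‖ / |(n : ℝ)| := by field_simp
      _ ≤ C / |(n : ℝ)| ^ p / |(n : ℝ)| := by gcongr; exact hC n hn
      _ = _ := by rw [div_div]

/-- Fourier series of a smooth periodic even function, as a cosine series. -/
lemma hasSum_cos_of_even (F : ℝ → ℂ) (hF : ContDiff ℝ (⊤ : ℕ∞) F)
    (hper : Function.Periodic F (2 * Real.pi)) (heven : ∀ x, F (-x) = F x) (x : ℝ) :
    HasSum (fun n : ℤ => fourierCoeffOn Real.two_pi_pos F n * Complex.cos (n * x)) (F x) := by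
  have : Fact (0 < 2 * Real.pi) := ⟨Real.two_pi_pos⟩
  let f : C(AddCircle (2 * Real.pi), ℂ) := ⟨hper.lift, continuous_coinduced_dom.mpr hF.continuous⟩
  have hcoe : ∀ n, fourierCoeff f n = fourierCoeffOn Real.two_pi_pos F n := by
    intro n
    rw [fourierCoeffOn_eq_integral, fourierCoeff_eq_intervalIntegral _ _ 0]
    simp [f]
  obtain ⟨C, hC⟩ := exists_fourierCoeffOn_le 2 F hF hper
  have hsum : Summable (fourierCoeff f) := by
    refine Summable.of_norm_bounded_eventually
      (g := fun n : ℤ => C / |(n : ℝ)| ^ 2) ?_ ?_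
    · simpa [div_eq_mul_inv, sq_abs] using
        ((Real.summable_one_div_int_pow (p := 2)).mpr (by norm_num)).mul_left C
    · filter_upwards [(Set.finite_singleton (0 : ℤ)).compl_mem_cofinite] with n hn
      rw [hcoe]
      exact hC n hn
  have key : ∀ y : ℝ, HasSum (fun n : ℤ => fourierCoeffOn Real.two_pi_pos F n *
      Complex.exp (n * y * Complex.I)) (F y) := by
    intro y
    have h := has_pointwise_sum_fourier_series_of_summable hsum (y : AddCircle (2 * Real.pi))
    have e : f (y : AddCircle (2 * Real.pi)) = F y := rfl
    rw [e] at h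
    refine h.congr_fun ?_
    intro n
    rw [hcoe, smul_eq_mul, fourier_coe_apply]
    congr 2
    have : (Real.pi : ℂ) ≠ 0 := by exact_mod_cast Real.pi_ne_zero
    push_cast
    field_simp
  -- Averaging the series at `x` and `-x` turns exponentials into cosines.
  have h := ((key x).add (key (-x))).div_const 2
  rw [heven, add_self_div_two] at h
  refine h.congr_fun ?_
  intro n
  rw [Complex.cos]
  push_cast
  ring_nf

/-- Jackson type theorem: on a bounded interval, a smooth function is approximated by polynomials
of degree `k` up to `O(k^{-p})` for any `p`. -/
lemma exists_polynomial_approx {g : ℝ → ℂ} (hg : ContDiff ℝ (⊤ : ℕ∞) g) {M : ℝ} (hM : 0 < M)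
    (p : ℕ) : ∃ C : ℝ, 0 ≤ C ∧ ∀ k : ℕ, ∃ q : Polynomial ℂ, q.natDegree ≤ k ∧
      ∀ x : ℝ, |x| ≤ M → ‖g x - q.eval (x : ℂ)‖ ≤ C / ((k : ℝ) + 1) ^ p := by
  -- With `x = M cos θ` the cosine series of `F` becomes the Chebyshev series of `g` on `[-M, M]`.
  set F : ℝ → ℂ := fun θ => g (M * Real.cos θ) with hFdef
  have hF : ContDiff ℝ (⊤ : ℕ∞) F := hg.comp (contDiff_const.mul Real.contDiff_cos)
  have hper : Function.Periodic F (2 * Real.pi) := fun x => by simp [F]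
  have heven : ∀ x, F (-x) = F x := fun x => by simp [F]
  -- Of the exponent `p + 2`, the part `p` gives the rate and the part `2` makes the tail summable.
  obtain ⟨C, hC⟩ := exists_fourierCoeffOn_le (p + 2) F hF hper
  set c := fourierCoeffOn Real.two_pi_pos F
  have hC0 : 0 ≤ C := by simpa using (norm_nonneg _).trans (hC 1 one_ne_zero)
  have hs2 : Summable fun n : ℤ => 1 / (n : ℝ) ^ 2 :=
    (Real.summable_one_div_int_pow (p := 2)).mpr (by norm_num)
  refine ⟨C * ∑' n : ℤ, 1 / (n : ℝ) ^ 2, by positivity, fun k => ?_⟩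
  refine ⟨∑ n ∈ Finset.Icc (-k : ℤ) k, Polynomial.C (c n) *
    (Polynomial.Chebyshev.T ℂ n).comp (Polynomial.C (M⁻¹ : ℂ) * Polynomial.X), ?_, ?_⟩
  · refine Polynomial.natDegree_sum_le_of_forall_le _ _ fun n hn => ?_
    refine (Polynomial.natDegree_C_mul_le _ _).trans ?_
    refine Polynomial.natDegree_comp_le.trans ?_
    rw [Polynomial.Chebyshev.natDegree_T]
    have h1 : (Polynomial.C (M⁻¹ : ℂ) * Polynomial.X).natDegree ≤ 1 :=
      (Polynomial.natDegree_C_mul_le _ _).trans Polynomial.natDegree_X_le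
    have h2 : n.natAbs ≤ k := by
      rw [Finset.mem_Icc] at hn
      omega
    calc n.natAbs * _ ≤ n.natAbs * 1 := Nat.mul_le_mul_left _ h1
      _ ≤ k := by omega
  · intro x hx
    set θ := Real.arccos (x / M)
    have hcos : Real.cos θ = x / M := by
      rw [abs_le] at hx
      apply Real.cos_arccos
      · rw [le_div_iff₀ hM]; linarith
      · rw [div_le_one hM]; exact hx.2
    have hgx : g x = F θ := by
      simp only [F, hcos]
      congr 1
      field_simp
    have hq : (∑ n ∈ Finset.Icc (-k : ℤ) k, Polynomial.C (c n) *
        (Polynomial.Chebyshev.T ℂ n).comp (Polynomial.C (M⁻¹ : ℂ) * Polynomial.X)).eval (x : ℂ)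
        = ∑ n ∈ Finset.Icc (-k : ℤ) k, c n * Complex.cos (n * θ) := by
      rw [Polynomial.eval_finsetSum]
      refine Finset.sum_congr rfl fun n _ => ?_
      rw [← Polynomial.Chebyshev.T_complex_cos, ← Complex.ofReal_cos, hcos]
      simp [div_eq_inv_mul]
    rw [hq, hgx]
    have hsum := hasSum_cos_of_even F hF hper heven θ
    have htail := (Finset.hasSum_compl_iff (Finset.Icc (-k : ℤ) k)).mpr
      (by rwa [sub_add_cancel] : HasSum _
        ((F θ - ∑ n ∈ Finset.Icc (-k : ℤ) k, c n * Complex.cos (n * θ)) +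
          ∑ n ∈ Finset.Icc (-k : ℤ) k, c n * Complex.cos (n * θ)))
    have hk : (0 : ℝ) < (k : ℝ) + 1 := by positivity
    have hs3 : Summable fun n : {n // n ∉ Finset.Icc (-k : ℤ) k} =>
        C / ((k : ℝ) + 1) ^ p * (1 / ((n : ℤ) : ℝ) ^ 2) :=
      (hs2.subtype _).mul_left _
    calc ‖F θ - ∑ n ∈ Finset.Icc (-k : ℤ) k, c n * Complex.cos (n * θ)‖
        ≤ ∑' n : {n // n ∉ Finset.Icc (-k : ℤ) k},
            C / ((k : ℝ) + 1) ^ p * (1 / ((n : ℤ) : ℝ) ^ 2) := by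
          refine htail.tsum_eq ▸ tsum_of_norm_bounded hs3.hasSum ?_
          rintro ⟨n, hn⟩
          have hnk : (k : ℝ) + 1 ≤ |(n : ℝ)| := by
            have : (k : ℤ) + 1 ≤ |n| := by
              rw [Finset.mem_Icc, not_and_or] at hn
              rcases abs_cases n with h | h <;> omega
            exact_mod_cast this
          have hn0 : n ≠ 0 := by
            rintro rfl
            simp at hnk
            linarith
          have hcosle : ‖Complex.cos (n * θ)‖ ≤ 1 := by
            have : Complex.cos (n * θ) = ((Real.cos (n * θ) : ℝ) : ℂ) := by push_cast; rfl
            rw [this, Complex.norm_real]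
            exact Real.abs_cos_le_one _
          calc ‖c n * Complex.cos (n * θ)‖ ≤ C / |(n : ℝ)| ^ (p + 2) * 1 := by
                rw [norm_mul]
                exact mul_le_mul (hC n hn0) hcosle (norm_nonneg _) (by positivity)
            _ = C / |(n : ℝ)| ^ p * (1 / (n : ℝ) ^ 2) := by
                rw [pow_add, ← sq_abs (n : ℝ), mul_one, div_mul_div_comm, mul_one]
            _ ≤ _ := by gcongr
      _ = C / ((k : ℝ) + 1) ^ p *
            ∑' n : {n // n ∉ Finset.Icc (-k : ℤ) k}, 1 / ((n : ℤ) : ℝ) ^ 2 := tsum_mul_left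
      _ ≤ C / ((k : ℝ) + 1) ^ p * ∑' n : ℤ, 1 / (n : ℝ) ^ 2 := by
          gcongr
          exact hs2.tsum_subtype_le _ {n | n ∉ Finset.Icc (-k : ℤ) k} (fun _ => by positivity)
      _ = _ := by ring

end PolynomialApproximation

/-! ### Matrix elements and how they determine an operator. -/

section MatrixElements

lemma matrixElement_eq (A : Op) (n m : Lattice) :
    matrixElement A n m = A (lp.single 2 m (1 : ℂ)) n := by
  simp [matrixElement, lp.inner_single_left]

/-- Expand `ψ` in the standard basis and push the sum through the continuous functional `φ ↦ ⟨n|A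
φ⟩`. -/
lemma hasSum_apply (A : Op) (ψ : Ell2 Lattice) (n : Lattice) :
    HasSum (fun m => matrixElement A n m * ψ m) (A ψ n) := by
  have h := (innerSL ℂ (lp.single 2 n (1 : ℂ) : Ell2 Lattice) ∘L A).hasSum
    (lp.hasSum_single (p := 2) (by norm_num) ψ)
  have e : ((innerSL ℂ (lp.single 2 n (1 : ℂ) : Ell2 Lattice) ∘L A) ψ) = A ψ n := by
    simp [lp.inner_single_left]
  rw [e] at h
  refine h.congr_fun ?_
  · intro m
    have : (lp.single 2 m (ψ m) : Ell2 Lattice) = ψ m • lp.single 2 m (1 : ℂ) := by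
      rw [← lp.single_smul, smul_eq_mul, mul_one]
    rw [this, map_smul, smul_eq_mul, mul_comm]
    rfl

lemma op_ext {A B : Op} (h : ∀ n m, matrixElement A n m = matrixElement B n m) : A = B := by
  ext ψ n
  have h1 := hasSum_apply A ψ n
  simp_rw [h] at h1
  exact h1.unique (hasSum_apply B ψ n)

lemma norm_single_one (m : Lattice) : ‖(lp.single 2 m (1 : ℂ) : Ell2 Lattice)‖ = 1 := by
  rw [lp.norm_single (by norm_num), norm_one]

lemma norm_matrixElement_le_apply (A : Op) (n m : Lattice) :
    ‖matrixElement A n m‖ ≤ ‖A (lp.single 2 m (1 : ℂ))‖ := by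
  rw [matrixElement_eq]
  exact lp.norm_apply_le_norm (by norm_num) _ _

lemma norm_apply_single_le (A : Op) (m : Lattice) : ‖A (lp.single 2 m (1 : ℂ))‖ ≤ ‖A‖ := by
  simpa [norm_single_one] using A.le_opNorm (lp.single 2 m (1 : ℂ) : Ell2 Lattice)

lemma norm_matrixElement_le (A : Op) (n m : Lattice) : ‖matrixElement A n m‖ ≤ ‖A‖ :=
  (norm_matrixElement_le_apply A n m).trans (norm_apply_single_le A m)

lemma matrixElement_add (A B : Op) (n m : Lattice) :
    matrixElement (A + B) n m = matrixElement A n m + matrixElement B n m := by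
  simp [matrixElement]

lemma matrixElement_sub (A B : Op) (n m : Lattice) :
    matrixElement (A - B) n m = matrixElement A n m - matrixElement B n m := by
  simp [matrixElement]

lemma matrixElement_star (A : Op) (n m : Lattice) :
    matrixElement (star A) n m = star (matrixElement A m n) := by
  simp [matrixElement, ContinuousLinearMap.star_eq_adjoint,
    ContinuousLinearMap.adjoint_inner_right]

lemma hasSum_matrixElement_mul (A B : Op) (n m : Lattice) :
    HasSum (fun k => matrixElement A n k * matrixElement B k m) (matrixElement (A * B) n m) := by
  have h := hasSum_apply A (B (lp.single 2 m (1 : ℂ))) n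
  simp_rw [← matrixElement_eq B] at h
  rwa [matrixElement_eq (A * B)]

lemma matrixElement_aeval (A : Op) (q : Polynomial ℂ) (n m : Lattice) :
    matrixElement (Polynomial.aeval A q) n m =
      ∑ i ∈ Finset.range (q.natDegree + 1), q.coeff i * matrixElement (A ^ i) n m := by
  rw [Polynomial.aeval_eq_sum_range]
  simp only [matrixElement, sum_apply, inner_sum,
    smul_apply, inner_smul_right]

lemma tendsto_matrixElement {ι : Type*} {l : Filter ι} {A : ι → Op} {B : Op}
    (h : Tendsto A l (𝓝 B)) (n m : Lattice) :
    Tendsto (fun i => matrixElement (A i) n m) l (𝓝 (matrixElement B n m)) := by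
  rw [tendsto_iff_norm_sub_tendsto_zero] at h ⊢
  refine squeeze_zero (fun _ => norm_nonneg _) (fun i => ?_) h
  rw [← matrixElement_sub]
  exact norm_matrixElement_le _ n m

end MatrixElements

/-! ### Functional calculus, absolute values and the spectral gap. -/

section FunctionalCalculus

-- Nontriviality gives `‖1‖ = 1` in `Op`, which is used to bound the spectrum by the norm.
instance : Nontrivial (Ell2 Lattice) :=
  ⟨lp.single 2 0 (1 : ℂ), 0, fun h => by simpa [h] using norm_single_one 0⟩

section AbsoluteValue

variable {E : Type} [NormedAddCommGroup E] [InnerProductSpace ℂ E] [CompleteSpace E]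

lemma opAbs_cfc {f : ℂ → ℂ} (hf : Continuous f) {A : E →L[ℂ] E} (hA : IsStarNormal A) :
    opAbs (cfc f A) = cfc (fun z => (‖f z‖ : ℂ)) A := by
  have hn : IsStarNormal (cfc f A) := cfc_predicate _ _
  rw [opAbs, CFC.abs_eq_cfcₙ_coe_norm ℂ _ hn, cfcₙ_eq_cfc]
  exact (cfc_comp' (fun z : ℂ => (‖z‖ : ℂ)) f A (by fun_prop) hf.continuousOn).symm

/-- A consequence of `|A|² = A^* A`. It transfers the column decay of `g(H)` to `|g(H)|`, although
`|g|` need not be smooth. -/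
lemma norm_opAbs_apply (A : E →L[ℂ] E) (ψ : E) : ‖opAbs A ψ‖ = ‖A ψ‖ := by
  have hsa : star (CFC.abs A) = CFC.abs A := (CFC.abs_nonneg A).isSelfAdjoint
  have h : inner ℂ (opAbs A ψ) (opAbs A ψ) = inner ℂ (A ψ) (A ψ) := by
    rw [← ContinuousLinearMap.adjoint_inner_right, ← ContinuousLinearMap.adjoint_inner_right A,
      ← ContinuousLinearMap.star_eq_adjoint, ← ContinuousLinearMap.star_eq_adjoint, opAbs, hsa]
    exact congrArg (fun X : E →L[ℂ] E => inner ℂ ψ (X ψ)) (CFC.abs_mul_abs A)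
  rw [inner_self_eq_norm_sq_to_K, inner_self_eq_norm_sq_to_K] at h
  have h' : ‖opAbs A ψ‖ ^ 2 = ‖A ψ‖ ^ 2 := by exact_mod_cast h
  exact (pow_left_inj₀ (norm_nonneg _) (norm_nonneg _) two_ne_zero).mp h'

end AbsoluteValue

lemma continuous_comp_re {f : ℝ → ℂ} (hf : Continuous f) : Continuous fun z : ℂ => f z.re :=
  hf.comp Complex.continuous_re

lemma isStarNormal_applyFun (f : ℝ → ℂ) (A : Op) : IsStarNormal (applyFun f A) :=
  cfc_predicate _ _

lemma norm_applyFun_le {f : ℝ → ℂ} {A : Op} {M C : ℝ} (hM : ‖A‖ ≤ M)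
    (hC : 0 ≤ C) (h : ∀ x : ℝ, |x| ≤ M → ‖f x‖ ≤ C) : ‖applyFun f A‖ ≤ C := by
  refine norm_cfc_le hC fun z hz => h _ ?_
  exact (Complex.abs_re_le_norm z).trans ((spectrum.norm_le_norm_of_mem hz).trans hM)

lemma norm_applyFun_sub_aeval_le {f : ℝ → ℂ} (hf : Continuous f) {A : Op} {M ε : ℝ}
    (hA : IsSelfAdjoint A) (hM : ‖A‖ ≤ M) (hε : 0 ≤ ε) {q : Polynomial ℂ}
    (h : ∀ x : ℝ, |x| ≤ M → ‖f x - q.eval (x : ℂ)‖ ≤ ε) :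
    ‖applyFun f A - Polynomial.aeval A q‖ ≤ ε := by
  rw [← cfc_polynomial q A hA.isStarNormal, applyFun,
    ← cfc_sub _ _ A (continuous_comp_re hf).continuousOn q.continuous.continuousOn]
  refine norm_cfc_le hε fun z hz => ?_
  have hre := hA.mem_spectrum_eq_re hz
  have := h z.re
    ((Complex.abs_re_le_norm z).trans ((spectrum.norm_le_norm_of_mem hz).trans hM))
  rwa [← hre] at this

/-- A spectral point where `g` is nonzero would be real and lie in `Δ`, contradicting the gap. -/
lemma applyFun_eq_zero_of_isGap {g : ℝ → ℂ} {Δ : Set ℝ} (hg : Function.support g ⊆ Δ) {A : Op}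
    (hA : IsSelfAdjoint A) (hgap : IsGap Δ A) : applyFun g A = 0 := by
  rw [applyFun, cfc_congr (g := fun _ => 0), cfc_const_zero]
  intro z hz
  by_contra hne
  refine hgap z.re (hg hne) ?_
  rwa [← hA.mem_spectrum_eq_re hz]

lemma opAbs_applyFun {g : ℝ → ℂ} (hg : Continuous g) {A : Op} (hA : IsSelfAdjoint A) :
    opAbs (applyFun g A) = applyFun (fun x => (‖g x‖ : ℂ)) A :=
  opAbs_cfc (continuous_comp_re hg) hA.isStarNormal

end FunctionalCalculus

/-! ### Measurability of functions of operator families. -/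

section MeasurableFamilies

variable {Ω : Type*} [MeasurableSpace Ω]

/-- The matrix elements of a product are limits of finite sums along the finite subsets of the
countable lattice. -/
lemma IsMeasurableFamily.mul {A B : Ω → Op} (hA : IsMeasurableFamily A)
    (hB : IsMeasurableFamily B) : IsMeasurableFamily fun ω => A ω * B ω := by
  intro n m
  refine measurable_of_tendsto_metrizable' (u := atTop)
    (f := fun (s : Finset Lattice) ω => ∑ k ∈ s, matrixElement (A ω) n k * matrixElement (B ω) k m)
    (fun s => Finset.measurable_fun_sum s fun k _ => (hA n k).mul (hB k m)) ?_
  rw [tendsto_pi_nhds]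
  exact fun ω => hasSum_matrixElement_mul (A ω) (B ω) n m

lemma isMeasurableFamily_const (A : Op) : IsMeasurableFamily fun _ : Ω => A :=
  fun _ _ => measurable_const

lemma IsMeasurableFamily.pow {A : Ω → Op} (hA : IsMeasurableFamily A) (k : ℕ) :
    IsMeasurableFamily fun ω => A ω ^ k := by
  induction k with
  | zero => simpa using isMeasurableFamily_const 1
  | succ k ih => simpa only [pow_succ] using ih.mul hA

lemma IsMeasurableFamily.add {A B : Ω → Op} (hA : IsMeasurableFamily A)
    (hB : IsMeasurableFamily B) : IsMeasurableFamily fun ω => A ω + B ω := fun n m => by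
  simp only [matrixElement_add]
  exact (hA n m).add (hB n m)

lemma IsMeasurableFamily.aeval {A : Ω → Op} (hA : IsMeasurableFamily A) (q : Polynomial ℂ) :
    IsMeasurableFamily fun ω => Polynomial.aeval (A ω) q := by
  intro n m
  simp_rw [matrixElement_aeval]
  exact Finset.measurable_fun_sum _ fun i _ => (hA.pow i n m).const_mul _

lemma IsMeasurableFamily.of_tendsto {A : ℕ → Ω → Op} {B : Ω → Op}
    (hA : ∀ k, IsMeasurableFamily (A k)) (h : ∀ ω, Tendsto (fun k => A k ω) atTop (𝓝 (B ω))) :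
    IsMeasurableFamily B := fun n m =>
  measurable_of_tendsto_metrizable (fun k => hA k n m)
    (tendsto_pi_nhds.mpr fun ω => tendsto_matrixElement (h ω) n m)

/-- Weierstrass for the real and imaginary parts. It covers functions that are merely continuous,
such as `|g|`. -/
lemma exists_polynomial_near {f : ℝ → ℂ} (hf : Continuous f) (M : ℝ) {ε : ℝ} (hε : 0 < ε) :
    ∃ q : Polynomial ℂ, ∀ x : ℝ, |x| ≤ M → ‖f x - q.eval (x : ℂ)‖ ≤ ε := by
  obtain ⟨a, ha⟩ := exists_polynomial_near_of_continuousOn (-M) M (fun x => (f x).re)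
    (Complex.continuous_re.comp hf).continuousOn (ε / 2) (by positivity)
  obtain ⟨b, hb⟩ := exists_polynomial_near_of_continuousOn (-M) M (fun x => (f x).im)
    (Complex.continuous_im.comp hf).continuousOn (ε / 2) (by positivity)
  refine ⟨a.map Complex.ofRealHom + Polynomial.C Complex.I * b.map Complex.ofRealHom,
    fun x hx => ?_⟩
  have ha' := ha x (abs_le.mp hx)
  have hb' := hb x (abs_le.mp hx)
  have e : ∀ p : Polynomial ℝ, (p.map Complex.ofRealHom).eval (x : ℂ) = ((p.eval x : ℝ) : ℂ) :=
    fun p => Polynomial.eval_map_apply Complex.ofRealHom x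
  rw [Polynomial.eval_add, Polynomial.eval_mul, Polynomial.eval_C, e, e]
  refine (Complex.norm_le_abs_re_add_abs_im _).trans ?_
  rw [abs_sub_comm] at ha' hb'
  simp only [Complex.sub_re, Complex.add_re, Complex.ofReal_re, Complex.re_mul_ofReal,
    Complex.I_re, zero_mul, add_zero, Complex.sub_im, Complex.add_im, Complex.ofReal_im,
    Complex.im_mul_ofReal, Complex.I_im, one_mul, zero_add]
  linarith

/-- The polynomials do not depend on `A`. This uniformity lets measurability and continuity in `ω`
pass from polynomials to `f`. -/
lemma exists_tendsto_aeval {f : ℝ → ℂ} (hf : Continuous f) (M : ℝ) :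
    ∃ q : ℕ → Polynomial ℂ, ∀ A : Op, IsSelfAdjoint A → ‖A‖ ≤ M →
      ∀ k : ℕ, ‖applyFun f A - Polynomial.aeval A (q k)‖ ≤ 1 / ((k : ℝ) + 1) := by
  choose q hq using fun k : ℕ => exists_polynomial_near hf M
    (ε := 1 / ((k : ℝ) + 1)) (by positivity)
  exact ⟨q, fun A hA hM k => norm_applyFun_sub_aeval_le hf hA hM (by positivity) (hq k)⟩

lemma tendsto_of_norm_sub_le {A : ℕ → Op} {B : Op} (h : ∀ k : ℕ, ‖B - A k‖ ≤ 1 / ((k : ℝ) + 1)) :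
    Tendsto A atTop (𝓝 B) := by
  rw [tendsto_iff_norm_sub_tendsto_zero]
  refine squeeze_zero (fun _ => norm_nonneg _) (fun k => ?_)
    tendsto_one_div_add_atTop_nhds_zero_nat
  rw [norm_sub_rev]
  exact h k

lemma IsMeasurableFamily.applyFun {f : ℝ → ℂ} (hf : Continuous f) {A : Ω → Op} {M : ℝ}
    (hA : IsMeasurableFamily A) (hsa : ∀ ω, IsSelfAdjoint (A ω)) (hM : ∀ ω, ‖A ω‖ ≤ M) :
    IsMeasurableFamily fun ω => applyFun f (A ω) := by
  obtain ⟨q, hq⟩ := exists_tendsto_aeval hf M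
  exact .of_tendsto (fun k => hA.aeval (q k))
    fun ω => tendsto_of_norm_sub_le (hq _ (hsa ω) (hM ω))

end MeasurableFamilies

/-! ### Finite range operators and finite speed of propagation of polynomials. -/

section FiniteRange

/-- The operator `A` does not hop farther than `r`. -/
def HasRange (r : ℝ) (A : Op) : Prop := ∀ n m, r < dist n m → matrixElement A n m = 0

/-- The wave function `ψ` vanishes outside of `s`. -/
def SupportedIn (s : Set Lattice) (ψ : Ell2 Lattice) : Prop := ∀ n ∉ s, ψ n = 0

/-- The sites at distance at most `r` from `s`. -/
def thick (s : Set Lattice) (r : ℝ) : Set Lattice := {n | ∃ m ∈ s, dist n m ≤ r}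

lemma supportedIn_single (m : Lattice) : SupportedIn {m} (lp.single 2 m (1 : ℂ)) :=
  fun _ hn => lp.single_apply_ne 2 m 1 hn

lemma HasRange.mono {r r' : ℝ} {A : Op} (h : HasRange r A) (hr : r ≤ r') : HasRange r' A :=
  fun n m hnm => h n m (hr.trans_lt hnm)

lemma apply_eq_zero_of_matrixElement {A : Op} {s : Set Lattice} {n : Lattice} {ψ : Ell2 Lattice}
    (hψ : SupportedIn s ψ) (h : ∀ m ∈ s, matrixElement A n m = 0) : A ψ n = 0 := by
  refine (hasSum_apply A ψ n).unique ?_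
  convert hasSum_zero with m
  by_cases hm : m ∈ s
  · rw [h m hm, zero_mul]
  · rw [hψ m hm, mul_zero]

lemma HasRange.supportedIn {r : ℝ} {A : Op} (hA : HasRange r A) {s : Set Lattice}
    {ψ : Ell2 Lattice} (hψ : SupportedIn s ψ) : SupportedIn (thick s r) (A ψ) := by
  intro n hn
  refine apply_eq_zero_of_matrixElement hψ fun m hm => hA n m ?_
  by_contra! h
  exact hn ⟨m, hm, h⟩

lemma thick_thick_subset (s : Set Lattice) (a b : ℝ) : thick (thick s a) b ⊆ thick s (a + b) := by
  rintro n ⟨m, ⟨l, hl, hml⟩, hnm⟩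
  exact ⟨l, hl, (dist_triangle n m l).trans (by linarith)⟩

lemma thick_mono (s : Set Lattice) {a b : ℝ} (h : a ≤ b) : thick s a ⊆ thick s b :=
  fun _ ⟨m, hm, h'⟩ => ⟨m, hm, h'.trans h⟩

lemma SupportedIn.mono {s t : Set Lattice} {ψ : Ell2 Lattice} (h : SupportedIn s ψ)
    (hst : s ⊆ t) : SupportedIn t ψ := fun n hn => h n fun hs => hn (hst hs)

lemma HasRange.pow_supportedIn {r : ℝ} {A : Op} (hA : HasRange r A) {s : Set Lattice}
    {ψ : Ell2 Lattice} (hψ : SupportedIn s ψ) (k : ℕ) :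
    SupportedIn (thick s (k * r)) ((A ^ k) ψ) := by
  induction k with
  | zero => exact hψ.mono fun n hn => ⟨n, hn, by simp⟩
  | succ k ih =>
    rw [pow_succ']
    refine (hA.supportedIn ih).mono ((thick_thick_subset _ _ _).trans (thick_mono _ ?_))
    push_cast
    linarith

/-- Powers of two operators agree on a wave function which is supported far away from the region
where the operators differ. -/
lemma pow_apply_eq_of_agree {r : ℝ} (hr : 0 ≤ r) {A B : Op} (hB : HasRange r B)
    {s U : Set Lattice} (hU : ∀ φ, SupportedIn U φ → A φ = B φ) {ψ : Ell2 Lattice}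
    (hψ : SupportedIn s ψ) {k : ℕ} (hs : thick s (k * r) ⊆ U) {i : ℕ} (hi : i ≤ k) :
    (A ^ i) ψ = (B ^ i) ψ := by
  induction i with
  | zero => rfl
  | succ i ih =>
    have hsub : thick s (i * r) ⊆ U := by
      refine (thick_mono _ ?_).trans hs
      have : (i : ℝ) ≤ k := by exact_mod_cast (Nat.le_succ i).trans hi
      gcongr
    rw [pow_succ', pow_succ']
    change A ((A ^ i) ψ) = B ((B ^ i) ψ)
    rw [ih ((Nat.le_succ i).trans hi)]
    -- The iterate `B^i ψ` has not yet left the region `U`, where one more application of `A` or `B`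
    -- gives the same result.
    exact hU _ ((hB.pow_supportedIn hψ i).mono hsub)

lemma aeval_apply (A : Op) (q : Polynomial ℂ) (ψ : Ell2 Lattice) :
    Polynomial.aeval A q ψ =
      ∑ i ∈ Finset.range (q.natDegree + 1), q.coeff i • (A ^ i) ψ := by
  simp [Polynomial.aeval_eq_sum_range]

lemma aeval_apply_eq_of_agree {r : ℝ} (hr : 0 ≤ r) {A B : Op} (hB : HasRange r B)
    {s U : Set Lattice} (hU : ∀ φ, SupportedIn U φ → A φ = B φ) {ψ : Ell2 Lattice}
    (hψ : SupportedIn s ψ) {k : ℕ} (hs : thick s (k * r) ⊆ U) {q : Polynomial ℂ}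
    (hq : q.natDegree ≤ k) : Polynomial.aeval A q ψ = Polynomial.aeval B q ψ := by
  rw [aeval_apply, aeval_apply]
  refine Finset.sum_congr rfl fun i hi => ?_
  rw [pow_apply_eq_of_agree hr hB hU hψ hs ((Finset.mem_range_succ_iff.mp hi).trans hq)]

lemma HasRange.aeval {r : ℝ} (hr : 0 ≤ r) {A : Op} (hA : HasRange r A) {q : Polynomial ℂ} {k : ℕ}
    (hq : q.natDegree ≤ k) : HasRange (k * r) (Polynomial.aeval A q) := by
  intro n m hnm
  rw [matrixElement_aeval]
  refine Finset.sum_eq_zero fun i hi => ?_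
  rw [matrixElement_eq, hA.pow_supportedIn (supportedIn_single m) i n, mul_zero]
  rintro ⟨l, rfl, hl⟩
  have : (i : ℝ) ≤ k := by exact_mod_cast (Finset.mem_range_succ_iff.mp hi).trans hq
  have : i * r ≤ k * r := by gcongr
  linarith

/-- If `B` looks like `A` on the region `U`, and `g(B) = 0`, then `g(A)` is small on wave functions
supported far inside `U`. -/
lemma norm_applyFun_apply_le_of_agree {r M ε : ℝ} (hr : 0 ≤ r) (hε : 0 ≤ ε) {A B : Op}
    (hAsa : IsSelfAdjoint A) (hBsa : IsSelfAdjoint B) (hAM : ‖A‖ ≤ M) (hBM : ‖B‖ ≤ M)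
    (hB : HasRange r B) {g : ℝ → ℂ} (hg : Continuous g) (hgB : applyFun g B = 0)
    {s U : Set Lattice} (hU : ∀ φ, SupportedIn U φ → A φ = B φ) {ψ : Ell2 Lattice}
    (hψ : SupportedIn s ψ) {k : ℕ} (hs : thick s (k * r) ⊆ U) {q : Polynomial ℂ}
    (hq : q.natDegree ≤ k) (happrox : ∀ x : ℝ, |x| ≤ M → ‖g x - q.eval (x : ℂ)‖ ≤ ε) :
    ‖applyFun g A ψ‖ ≤ 2 * ε * ‖ψ‖ := by
  have h1 := (applyFun g A - Polynomial.aeval A q).le_of_opNorm_le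
    (norm_applyFun_sub_aeval_le hg hAsa hAM hε happrox) ψ
  have h2 := (applyFun g B - Polynomial.aeval B q).le_of_opNorm_le
    (norm_applyFun_sub_aeval_le hg hBsa hBM hε happrox) ψ
  have h3 := aeval_apply_eq_of_agree hr hB hU hψ hs hq
  -- As `q(A) ψ = q(B) ψ` and `g(B) = 0`, the vector `g(A) ψ` is a difference of two approximation
  -- errors, whence the factor `2`.
  have : applyFun g A ψ = (applyFun g A - Polynomial.aeval A q) ψ
      - (applyFun g B - Polynomial.aeval B q) ψ := by
    rw [sub_apply, sub_apply, h3, hgB]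
    simp
  rw [this]
  exact (norm_sub_le _ _).trans (by linarith)

end FiniteRange

/-! ### Continuity in `ω`, and passing from almost every to every `ω`. -/

section ContinuousFamilies

variable {Ω : Type*} [TopologicalSpace Ω]

/-- Finite range reduces the sum in a matrix product to a fixed finite ball; weak continuity alone
would not pass to products. -/
lemma continuous_matrixElement_pow {A : Ω → Op} {r : ℝ} (hr : ∀ ω, HasRange r (A ω))
    (hA : ∀ n m, Continuous fun ω => matrixElement (A ω) n m) (k : ℕ) (n m : Lattice) :
    Continuous fun ω => matrixElement (A ω ^ k) n m := by
  induction k generalizing n with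
  | zero => simpa using continuous_const
  | succ k ih =>
    have hfin : (Metric.closedBall n r).Finite := (isCompact_closedBall n r).finite_of_discrete
    have h : ∀ ω, matrixElement (A ω ^ (k + 1)) n m =
        ∑ l ∈ hfin.toFinset, matrixElement (A ω) n l * matrixElement (A ω ^ k) l m := by
      intro ω
      rw [pow_succ']
      refine (hasSum_matrixElement_mul _ _ n m).unique (hasSum_sum_of_ne_finset_zero ?_)
      intro l hl
      rw [hr ω n l, zero_mul]
      simpa [dist_comm] using hl
    simp_rw [h]
    exact continuous_finsetSum _ fun l _ => (hA n l).mul (ih l)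

lemma continuous_matrixElement_applyFun {f : ℝ → ℂ} (hf : Continuous f) {A : Ω → Op} {r M : ℝ}
    (hr : ∀ ω, HasRange r (A ω)) (hsa : ∀ ω, IsSelfAdjoint (A ω)) (hM : ∀ ω, ‖A ω‖ ≤ M)
    (hA : ∀ n m, Continuous fun ω => matrixElement (A ω) n m) (n m : Lattice) :
    Continuous fun ω => matrixElement (applyFun f (A ω)) n m := by
  obtain ⟨q, hq⟩ := exists_tendsto_aeval hf M
  have hcont : ∀ k, Continuous fun ω => matrixElement (Polynomial.aeval (A ω) (q k)) n m := by
    intro k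
    simp_rw [matrixElement_aeval]
    exact continuous_finsetSum _ fun i _ =>
      continuous_const.mul (continuous_matrixElement_pow hr hA i n m)
  refine TendstoUniformly.continuous (F := fun k ω =>
    matrixElement (Polynomial.aeval (A ω) (q k)) n m) (p := atTop) ?_ (Frequently.of_forall hcont)
  rw [Metric.tendstoUniformly_iff]
  intro ε hε
  filter_upwards [tendsto_one_div_add_atTop_nhds_zero_nat.eventually (gt_mem_nhds hε)] with k hk ω
  rw [dist_eq_norm, ← matrixElement_sub]
  exact ((norm_matrixElement_le _ n m).trans (hq _ (hsa ω) (hM ω) k)).trans_lt hk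

/-- A spectral gap on a set of full measure forces `g(A_ω) = 0` for all `ω`. -/
lemma applyFun_eq_zero_of_ae [MeasurableSpace Ω] {P : Measure Ω} [P.IsOpenPosMeasure]
    {f : ℝ → ℂ} (hf : Continuous f) {A : Ω → Op} {r M : ℝ}
    (hr : ∀ ω, HasRange r (A ω)) (hsa : ∀ ω, IsSelfAdjoint (A ω)) (hM : ∀ ω, ‖A ω‖ ≤ M)
    (hA : ∀ n m, Continuous fun ω => matrixElement (A ω) n m)
    (h : ∀ᵐ ω ∂P, applyFun f (A ω) = 0) (ω : Ω) : applyFun f (A ω) = 0 := by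
  refine op_ext fun n m => ?_
  -- Full support makes a set of full measure dense, and continuous matrix elements that vanish on a
  -- dense set vanish everywhere.
  have hd : Dense {ω | applyFun f (A ω) = 0} := Measure.dense_of_ae h
  have hcont := continuous_matrixElement_applyFun hf hr hsa hM hA n m
  exact congrFun (hcont.ext_on hd (continuous_const (y := matrixElement 0 n m))
    fun ω (hω : applyFun f (A ω) = 0) => by simp only [hω]) ω

end ContinuousFamilies

/-! ### Projections onto sets of sites. -/

section Projections

/-- The orthogonal projection of `ℓ²(ℤ²)` onto `ℓ²(s)`. -/
def proj (s : Set Lattice) : Op :=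
  (pull (Function.Embedding.subtype (· ∈ s)) 1).adjoint ∘L
    pull (Function.Embedding.subtype (· ∈ s)) 1

lemma norm_pull_le {ι κ : Type} (f : ι ↪ κ) (u : ι → Circle) : ‖pull f u‖ ≤ 1 :=
  LinearMap.mkContinuous_norm_le _ zero_le_one _

lemma norm_proj_le (s : Set Lattice) : ‖proj s‖ ≤ 1 := by
  refine (ContinuousLinearMap.opNorm_comp_le _ _).trans ?_
  rw [LinearIsometryEquiv.norm_map]
  exact mul_le_one₀ (norm_pull_le _ _) (norm_nonneg _) (norm_pull_le _ _)

lemma norm_proj_apply_le (s : Set Lattice) (ψ : Ell2 Lattice) : ‖proj s ψ‖ ≤ ‖ψ‖ := by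
  simpa using (proj s).le_of_opNorm_le (norm_proj_le s) ψ

open Classical in
lemma proj_apply (s : Set Lattice) (ψ : Ell2 Lattice) (n : Lattice) :
    proj s ψ n = if n ∈ s then ψ n else 0 := by
  have h : proj s ψ n = inner ℂ (lp.single 2 n (1 : ℂ) : Ell2 Lattice) (proj s ψ) := by
    simp [lp.inner_single_left]
  rw [h, proj, ContinuousLinearMap.comp_apply, ContinuousLinearMap.adjoint_inner_right]
  split_ifs with hn
  · have e : pull (Function.Embedding.subtype (· ∈ s)) 1 (lp.single 2 n (1 : ℂ)) =
        (lp.single 2 (⟨n, hn⟩ : {n // n ∈ s}) (1 : ℂ) : Ell2 {n // n ∈ s}) := by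
      ext i
      rw [pull_apply]
      by_cases hi : i = ⟨n, hn⟩
      · subst hi
        simp
      · have hi' : (i : Lattice) ≠ n := fun h => hi (Subtype.ext h)
        simp [hi, hi']
    rw [e, lp.inner_single_left, pull_apply]
    simp
  · have e : pull (Function.Embedding.subtype (· ∈ s)) 1 (lp.single 2 n (1 : ℂ)) =
        (0 : Ell2 {n // n ∈ s}) := by
      ext i
      rw [pull_apply]
      have hi' : (i : Lattice) ≠ n := fun h => hn (h ▸ i.2)
      simp [hi']
    rw [e, inner_zero_left]

lemma star_proj (s : Set Lattice) : star (proj s) = proj s := by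
  rw [ContinuousLinearMap.star_eq_adjoint, proj, ContinuousLinearMap.adjoint_comp,
    ContinuousLinearMap.adjoint_adjoint]

lemma proj_apply_of_supportedIn {s : Set Lattice} {ψ : Ell2 Lattice} (h : SupportedIn s ψ) :
    proj s ψ = ψ := by
  ext n
  rw [proj_apply]
  split_ifs with hn
  · rfl
  · exact (h n hn).symm

lemma proj_apply_of_disjoint {s t : Set Lattice} {ψ : Ell2 Lattice} (h : SupportedIn s ψ)
    (hst : Disjoint s t) : proj t ψ = 0 := by
  ext n
  rw [proj_apply]
  split_ifs with hn
  · exact h n fun hs => Set.disjoint_left.mp hst hs hn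
  · rfl

lemma supportedIn_proj (s : Set Lattice) (ψ : Ell2 Lattice) : SupportedIn s (proj s ψ) :=
  fun n hn => by rw [proj_apply, if_neg hn]

lemma matrixElement_proj_mul_proj (s : Set Lattice) (A : Op) (n m : Lattice)
    (h : n ∉ s ∨ m ∉ s) : matrixElement (proj s * A * proj s) n m = 0 := by
  rw [matrixElement_eq]
  change proj s (A (proj s (lp.single 2 m 1))) n = 0
  rcases h with h | h
  · exact supportedIn_proj s _ n h
  · rw [proj_apply_of_disjoint (supportedIn_single m) (by simpa using h), map_zero, map_zero]
    rfl

lemma matrixElement_proj_mul_proj_eq (s : Set Lattice) (A : Op) (n m : Lattice)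
    (h : n ∈ s) (h' : m ∈ s) :
    matrixElement (proj s * A * proj s) n m = matrixElement A n m := by
  rw [matrixElement_eq, matrixElement_eq]
  change proj s (A (proj s (lp.single 2 m 1))) n = _
  rw [proj_apply_of_supportedIn ((supportedIn_single m).mono (by simpa using h')), proj_apply,
    if_pos h]

end Projections

/-! ### Magnetic translations and covariance. -/

section Translations

lemma translation_apply (u : Phases) (j : Fin 2) (ψ : Ell2 Lattice) (n : Lattice) :
    translation u j ψ n = u j n * ψ (n - unitVec j) := rfl

/-- The inverse of a magnetic translation. -/
def translationInv (u : Phases) (j : Fin 2) : Op :=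
  pull (Equiv.addRight (unitVec j)).toEmbedding fun n => (u j (n + unitVec j))⁻¹

lemma translationInv_apply (u : Phases) (j : Fin 2) (ψ : Ell2 Lattice) (n : Lattice) :
    translationInv u j ψ n = ((u j (n + unitVec j))⁻¹ : Circle) * ψ (n + unitVec j) := rfl

lemma translation_mul_inv (u : Phases) (j : Fin 2) : translation u j * translationInv u j = 1 := by
  ext ψ n
  change translation u j (translationInv u j ψ) n = ψ n
  rw [translation_apply, translationInv_apply, sub_add_cancel, ← mul_assoc, ← Circle.coe_mul,
    mul_inv_cancel, Circle.coe_one, one_mul]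

lemma norm_translation_apply (u : Phases) (j : Fin 2) (ψ : Ell2 Lattice) :
    ‖translation u j ψ‖ = ‖ψ‖ := by
  have h1 : ‖translation u j ψ‖ ≤ ‖ψ‖ := by
    simpa using (translation u j).le_of_opNorm_le (norm_pull_le _ _) ψ
  have h2 : ‖translationInv u j (translation u j ψ)‖ ≤ ‖translation u j ψ‖ := by
    simpa using (translationInv u j).le_of_opNorm_le (norm_pull_le _ _) (translation u j ψ)
  have h3 : translationInv u j (translation u j ψ) = ψ := by
    ext n
    rw [translationInv_apply, translation_apply, add_sub_cancel_right, ← mul_assoc,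
      ← Circle.coe_mul, inv_mul_cancel, Circle.coe_one, one_mul]
  rw [h3] at h2
  exact le_antisymm h1 h2

lemma star_translation_mul (u : Phases) (j : Fin 2) :
    star (translation u j) * translation u j = 1 := by
  rw [ContinuousLinearMap.star_eq_adjoint]
  exact (ContinuousLinearMap.norm_map_iff_adjoint_comp_self _).mp (norm_translation_apply u j)

lemma translation_mul_star (u : Phases) (j : Fin 2) :
    translation u j * star (translation u j) = 1 := by
  have h : star (translation u j) = translationInv u j :=
    left_inv_eq_right_inv (star_translation_mul u j) (translation_mul_inv u j)
  rw [h, translation_mul_inv]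

/-- A magnetic translation as a unitary operator. -/
def unitaryTranslation (u : Phases) (j : Fin 2) : unitary Op :=
  ⟨translation u j, Unitary.mem_iff.mpr ⟨star_translation_mul u j, translation_mul_star u j⟩⟩

/-- Conjugation with a magnetic translation, `A ↦ S_j^* A S_j`. -/
def conjTranslation (u : Phases) (j : Fin 2) : Op ≃⋆ₐ[ℂ] Op :=
  Unitary.conjStarAlgAut ℂ Op (star (unitaryTranslation u j))

lemma conjTranslation_apply (u : Phases) (j : Fin 2) (A : Op) :
    conjTranslation u j A = star (translation u j) * A * translation u j := by
  simp [conjTranslation, unitaryTranslation]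

variable {Ω : Type*} [AddAction (ℤ × ℤ) Ω]

lemma isCovariant_iff {u : Phases} {j : Fin 2} {A : Ω → Op} :
    IsCovariant u j A ↔ ∀ ω, conjTranslation u j (A ω) = A (unitVec j +ᵥ ω) := by
  simp_rw [conjTranslation_apply]
  rfl

lemma continuous_conjTranslation (u : Phases) (j : Fin 2) : Continuous (conjTranslation u j) := by
  have h : ⇑(conjTranslation u j) = fun A => star (translation u j) * A * translation u j :=
    funext (conjTranslation_apply u j)
  rw [h]
  fun_prop

/-- Conjugation by a unitary is a continuous star automorphism, hence commutes with the functional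
calculus. -/
lemma IsCovariant.applyFun {u : Phases} {j : Fin 2} {A : Ω → Op} (hA : IsCovariant u j A)
    (hsa : ∀ ω, IsSelfAdjoint (A ω)) {f : ℝ → ℂ} (hf : Continuous f) :
    IsCovariant u j fun ω => applyFun f (A ω) := by
  rw [isCovariant_iff] at hA ⊢
  intro ω
  have h1 : IsStarNormal (A ω) := (hsa ω).isStarNormal
  have h2 : IsStarNormal (conjTranslation u j (A ω)) := by
    rw [hA]
    exact (hsa _).isStarNormal
  simp only [Interface.applyFun]
  rw [← hA]
  exact StarAlgHomClass.map_cfc (S := ℂ) (conjTranslation u j) (fun z : ℂ => f z.re) (A ω)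
    (continuous_comp_re hf).continuousOn (continuous_conjTranslation u j) h1 h2

lemma IsCovariant.aeval {u : Phases} {j : Fin 2} {A : Ω → Op} (hA : IsCovariant u j A)
    (q : Polynomial ℂ) : IsCovariant u j fun ω => Polynomial.aeval (A ω) q := by
  rw [isCovariant_iff] at hA ⊢
  intro ω
  rw [← hA]
  exact (Polynomial.aeval_algHom_apply (conjTranslation u j).toStarAlgHom.toAlgHom (A ω) q).symm

lemma IsCovariant.mul {u : Phases} {j : Fin 2} {A B : Ω → Op} (hA : IsCovariant u j A)
    (hB : IsCovariant u j B) : IsCovariant u j fun ω => A ω * B ω := by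
  rw [isCovariant_iff] at *
  exact fun ω => by rw [map_mul, hA, hB]

lemma IsCovariant.add {u : Phases} {j : Fin 2} {A B : Ω → Op} (hA : IsCovariant u j A)
    (hB : IsCovariant u j B) : IsCovariant u j fun ω => A ω + B ω := by
  rw [isCovariant_iff] at *
  exact fun ω => by rw [map_add, hA, hB]

/-- A set of sites which is invariant under translations along the interface. -/
def IsStrip (s : Set Lattice) : Prop := ∀ n, n - unitVec 0 ∈ s ↔ n ∈ s

lemma proj_mul_translation {s : Set Lattice} (hs : IsStrip s) (u : Phases) :
    proj s * translation u 0 = translation u 0 * proj s := by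
  classical
  ext ψ n
  change proj s (translation u 0 ψ) n = translation u 0 (proj s ψ) n
  rw [proj_apply, translation_apply, translation_apply, proj_apply]
  simp only [hs n, mul_ite, mul_zero]

lemma isCovariant_proj {s : Set Lattice} (hs : IsStrip s) (u : Phases) :
    IsCovariant u 0 fun _ : Ω => proj s := by
  rw [isCovariant_iff]
  intro ω
  rw [conjTranslation_apply, mul_assoc, proj_mul_translation hs, ← mul_assoc,
    star_translation_mul, one_mul]

/-- The translation along the interface preserves `s`, so a compression to `s` sees only the phases
on `s`. This replaces the gauge of each bulk operator by the joined one. -/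
lemma IsCovariant.proj_mul_proj {u v : Phases} {A : Ω → Op} (hA : IsCovariant u 0 A)
    {s : Set Lattice} (hs : IsStrip s) (huv : ∀ n ∈ s, u 0 n = v 0 n) :
    IsCovariant v 0 fun ω => proj s * A ω * proj s := by
  have h : translation v 0 * proj s = translation u 0 * proj s := by
    classical
    ext ψ n
    change translation v 0 (proj s ψ) n = translation u 0 (proj s ψ) n
    rw [translation_apply, translation_apply, proj_apply]
    split_ifs with hn
    · rw [huv n ((hs n).mp hn)]
    · simp
  have h' : proj s * star (translation v 0) = proj s * star (translation u 0) := by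
    have := congrArg star h
    rwa [star_mul, star_mul, star_proj] at this
  have h'' : star (translation v 0) * proj s = proj s * star (translation v 0) := by
    have := congrArg star (proj_mul_translation hs v)
    rwa [star_mul, star_mul, star_proj] at this
  rw [isCovariant_iff] at hA ⊢
  intro ω
  rw [← hA, conjTranslation_apply, conjTranslation_apply]
  calc star (translation v 0) * (proj s * A ω * proj s) * translation v 0
      = (star (translation v 0) * proj s) * A ω * (proj s * translation v 0) := by noncomm_ring
    _ = (proj s * star (translation u 0)) * A ω * (translation u 0 * proj s) := by
        rw [h'', h', proj_mul_translation hs, h]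
    _ = _ := by noncomm_ring

end Translations

/-! ### The interface Hamiltonian agrees with the bulk away from the interface. -/

section InterfaceHamiltonian

/-- True by unfolding, because `Π^* Π` is `proj` of the half space. -/
lemma interfaceHamiltonian_eq {Ω : Type*} (Hp Hm K : Ω → Op) (ω : Ω) :
    interfaceHamiltonian Hp Hm K ω = proj (halfSpace true) * Hp ω * proj (halfSpace true)
      + proj (halfSpace false) * Hm ω * proj (halfSpace false) + K ω := rfl

lemma interfaceHamiltonian_apply {Ω : Type*} (Hp Hm K : Ω → Op) (ω : Ω) (φ : Ell2 Lattice) :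
    interfaceHamiltonian Hp Hm K ω φ =
      proj (halfSpace true) (Hp ω (proj (halfSpace true) φ))
        + proj (halfSpace false) (Hm ω (proj (halfSpace false) φ)) + K ω φ := rfl

lemma isStrip_halfSpace (b : Bool) : IsStrip (halfSpace b) := by
  intro n
  cases b <;> simp [halfSpace, unitVec]

lemma disjoint_halfSpace : Disjoint (halfSpace true) (halfSpace false) :=
  Set.disjoint_left.mpr fun n (h1 : 0 ≤ n.2) (h2 : n.2 < 0) => h2.not_ge h1

lemma isSelfAdjoint_proj_mul_proj {A : Op} (hA : IsSelfAdjoint A) (s : Set Lattice) :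
    IsSelfAdjoint (proj s * A * proj s) := by
  rw [isSelfAdjoint_iff, star_mul, star_mul, star_proj, hA.star_eq, mul_assoc]

lemma norm_proj_mul_proj_le (A : Op) (s : Set Lattice) : ‖proj s * A * proj s‖ ≤ ‖A‖ := by
  have h := norm_proj_le s
  calc ‖proj s * A * proj s‖ ≤ ‖proj s‖ * ‖A‖ * ‖proj s‖ := by
        refine (norm_mul_le _ _).trans ?_
        gcongr
        exact norm_mul_le _ _
    _ ≤ 1 * ‖A‖ * 1 := by gcongr
    _ = ‖A‖ := by ring

lemma HasRange.proj_mul_proj {r : ℝ} {A : Op} (hA : HasRange r A) (s : Set Lattice) :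
    HasRange r (proj s * A * proj s) := by
  intro n m hnm
  by_cases h : n ∉ s ∨ m ∉ s
  · exact matrixElement_proj_mul_proj s A n m h
  · push Not at h
    rw [matrixElement_proj_mul_proj_eq s A n m h.1 h.2, hA n m hnm]

lemma HasRange.add {r : ℝ} {A B : Op} (hA : HasRange r A) (hB : HasRange r B) :
    HasRange r (A + B) := fun n m h => by
  rw [matrixElement_add, hA n m h, hB n m h, add_zero]

/-- The sites above the line `n₂ = c`. -/
def above (c : ℝ) : Set Lattice := {n | c < n.2}

/-- The sites below the line `n₂ = -c`. -/
def below (c : ℝ) : Set Lattice := {n | (n.2 : ℝ) < -c}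

lemma abs_snd_sub_le_dist (n m : Lattice) : |(n.2 : ℝ) - m.2| ≤ dist n m := by
  rw [← Int.dist_eq]
  exact le_max_right _ _

lemma abs_fst_sub_le_dist (n m : Lattice) : |(n.1 : ℝ) - m.1| ≤ dist n m := by
  rw [← Int.dist_eq]
  exact le_max_left _ _

lemma thick_above_subset {c r c' : ℝ} (h : c' + r ≤ c) : thick (above c) r ⊆ above c' := by
  rintro n ⟨m, hm, hnm⟩
  have h1 := (abs_le.mp ((abs_snd_sub_le_dist n m).trans hnm)).1
  change c < m.2 at hm
  change c' < n.2
  linarith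

lemma thick_below_subset {c r c' : ℝ} (h : c' + r ≤ c) : thick (below c) r ⊆ below c' := by
  rintro n ⟨m, hm, hnm⟩
  have h1 := (abs_le.mp ((abs_snd_sub_le_dist n m).trans hnm)).2
  change (m.2 : ℝ) < -c at hm
  change (n.2 : ℝ) < -c'
  linarith

/-- `A` is an interface operator: self-adjoint, bounded by `M`, of range `r`, and equal to the
bulk operators `B` and `B'` at distance more than `L` above and below the interface. -/
structure IsInterfaceOf (M r L : ℝ) (A B B' : Op) : Prop where
  sa : IsSelfAdjoint A
  sa_above : IsSelfAdjoint B
  sa_below : IsSelfAdjoint B'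
  norm_le : ‖A‖ ≤ M
  norm_above_le : ‖B‖ ≤ M
  norm_below_le : ‖B'‖ ≤ M
  range : HasRange r A
  range_above : HasRange r B
  range_below : HasRange r B'
  agree_above : ∀ φ, SupportedIn (above L) φ → A φ = B φ
  agree_below : ∀ φ, SupportedIn (below L) φ → A φ = B' φ

lemma exists_isInterfaceOf {Ω : Type*} [AddAction (ℤ × ℤ) Ω] [MeasurableSpace Ω]
    {up um : Phases} {Hp Hm K : Ω → Op} (hHp : IsBulkFamily up Hp) (hHm : IsBulkFamily um Hm)
    (hK : IsCoupling (joinPhases up um) K) :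
    ∃ M r L : ℝ, 0 < M ∧ 1 ≤ r ∧ 0 ≤ L ∧
      ∀ ω, IsInterfaceOf M r L (interfaceHamiltonian Hp Hm K ω) (Hp ω) (Hm ω) := by
  obtain ⟨Mp, hMp⟩ := hHp.bounded
  obtain ⟨Mm, hMm⟩ := hHm.bounded
  obtain ⟨MK, hMK⟩ := hK.bounded
  obtain ⟨rp, hrp⟩ := hHp.shortRange
  obtain ⟨rm, hrm⟩ := hHm.shortRange
  obtain ⟨rK, hrK⟩ := hK.shortRange
  obtain ⟨N, hN⟩ := hK.strip
  -- One `M` and one `r` serve all three operators; the absolute values and the added `1` ensure `0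
  -- < M` and `1 ≤ r`.
  set M := |Mp| + |Mm| + |MK| + 1 with hM
  set r := |rp| + |rm| + |rK| + 1 with hr
  have a1 := abs_nonneg Mp
  have a2 := abs_nonneg Mm
  have a3 := abs_nonneg MK
  have b1 := abs_nonneg rp
  have b2 := abs_nonneg rm
  have b3 := abs_nonneg rK
  have c1 := le_abs_self Mp
  have c2 := le_abs_self Mm
  have c3 := le_abs_self MK
  have d1 := le_abs_self rp
  have d2 := le_abs_self rm
  have d3 := le_abs_self rK
  have hN0 : (0 : ℝ) ≤ N := N.cast_nonneg
  -- Beyond height `N` the coupling vanishes; the further `r` keeps the image under the bulk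
  -- operator inside the same half space.
  refine ⟨M, r, N + r, by linarith, by linarith, by linarith, fun ω => ?_⟩
  have hrangep : HasRange r (Hp ω) := HasRange.mono (hrp ω) (by linarith)
  have hrangem : HasRange r (Hm ω) := HasRange.mono (hrm ω) (by linarith)
  have hrangeK : HasRange r (K ω) := HasRange.mono (hrK ω) (by linarith)
  have hKzero : ∀ {s : Set Lattice}, (∀ n ∈ s, (N : ℝ) < |(n.2 : ℝ)|) → ∀ φ, SupportedIn s φ →
      K ω φ = 0 := by
    intro s hs φ hφ
    ext n
    refine apply_eq_zero_of_matrixElement hφ fun m hm => hN ω n m (Or.inr ?_)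
    exact_mod_cast hs m hm
  refine
    { sa := ?_
      sa_above := hHp.selfAdjoint ω
      sa_below := hHm.selfAdjoint ω
      norm_le := ?_
      norm_above_le := (hMp ω).trans (by linarith)
      norm_below_le := (hMm ω).trans (by linarith)
      range := ?_
      range_above := hrangep
      range_below := hrangem
      agree_above := fun φ hφ => ?_
      agree_below := fun φ hφ => ?_ }
  · rw [interfaceHamiltonian_eq]
    exact ((isSelfAdjoint_proj_mul_proj (hHp.selfAdjoint ω) _).add
      (isSelfAdjoint_proj_mul_proj (hHm.selfAdjoint ω) _)).add (hK.selfAdjoint ω)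
  · rw [interfaceHamiltonian_eq]
    have h1 := (norm_proj_mul_proj_le (Hp ω) (halfSpace true)).trans (hMp ω)
    have h2 := (norm_proj_mul_proj_le (Hm ω) (halfSpace false)).trans (hMm ω)
    have h3 := hMK ω
    refine (norm_add₃_le).trans ?_
    linarith
  · rw [interfaceHamiltonian_eq]
    exact ((hrangep.proj_mul_proj _).add (hrangem.proj_mul_proj _)).add hrangeK
  · have hs : ∀ {c : ℝ}, 0 ≤ c → above c ⊆ halfSpace true := by
      intro c hc n hn
      have : (0 : ℝ) < n.2 := hc.trans_lt hn
      exact_mod_cast this.le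
    have h1 : proj (halfSpace true) φ = φ := proj_apply_of_supportedIn (hφ.mono (hs (by linarith)))
    have h2 : proj (halfSpace false) φ = 0 :=
      proj_apply_of_disjoint (hφ.mono (hs (by linarith))) disjoint_halfSpace
    have h3 : proj (halfSpace true) (Hp ω φ) = Hp ω φ := proj_apply_of_supportedIn
      ((hrangep.supportedIn hφ).mono ((thick_above_subset le_rfl).trans (hs hN0)))
    have h4 : K ω φ = 0 := by
      refine hKzero (fun n (hn : N + r < (n.2 : ℝ)) => ?_) φ hφ
      exact lt_of_lt_of_le (by linarith) (le_abs_self _)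
    rw [interfaceHamiltonian_apply, h1, h2, h3, h4]
    simp
  · have hs : ∀ {c : ℝ}, 0 ≤ c → below c ⊆ halfSpace false := by
      intro c hc n hn
      have : (n.2 : ℝ) < 0 := lt_of_lt_of_le hn (by linarith)
      exact_mod_cast this
    have h1 : proj (halfSpace false) φ = φ := proj_apply_of_supportedIn (hφ.mono (hs (by linarith)))
    have h2 : proj (halfSpace true) φ = 0 :=
      proj_apply_of_disjoint (hφ.mono (hs (by linarith))) disjoint_halfSpace.symm
    have h3 : proj (halfSpace false) (Hm ω φ) = Hm ω φ := proj_apply_of_supportedIn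
      ((hrangem.supportedIn hφ).mono ((thick_below_subset le_rfl).trans (hs hN0)))
    have h4 : K ω φ = 0 := by
      refine hKzero (fun n (hn : (n.2 : ℝ) < -(N + r)) => ?_) φ hφ
      exact lt_of_lt_of_le (by linarith) (neg_le_abs _)
    rw [interfaceHamiltonian_apply, h1, h2, h3, h4]
    simp

lemma isMeasurableFamily_interfaceHamiltonian {Ω : Type*} [MeasurableSpace Ω] {Hp Hm K : Ω → Op}
    (hHp : IsMeasurableFamily Hp) (hHm : IsMeasurableFamily Hm) (hK : IsMeasurableFamily K) :
    IsMeasurableFamily (interfaceHamiltonian Hp Hm K) := by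
  have h : ∀ {A : Ω → Op} (s : Set Lattice), IsMeasurableFamily A →
      IsMeasurableFamily fun ω => proj s * A ω * proj s := fun s hA =>
    ((isMeasurableFamily_const _).mul hA).mul (isMeasurableFamily_const _)
  exact ((h _ hHp).add (h _ hHm)).add hK

lemma isCovariant_interfaceHamiltonian {Ω : Type*} [AddAction (ℤ × ℤ) Ω] {up um : Phases}
    {Hp Hm K : Ω → Op} (hHp : IsCovariant up 0 Hp) (hHm : IsCovariant um 0 Hm)
    (hK : IsCovariant (joinPhases up um) 0 K) :
    IsCovariant (joinPhases up um) 0 (interfaceHamiltonian Hp Hm K) :=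
  ((hHp.proj_mul_proj (isStrip_halfSpace true) fun _ hn => (if_pos hn).symm).add
    (hHm.proj_mul_proj (isStrip_halfSpace false) fun _ hn => (if_neg (not_le.mpr hn)).symm)).add hK

end InterfaceHamiltonian

/-! ### Decay of the matrix elements of `g(H)`. -/

section Decay

variable {M r L : ℝ} {A B B' : Op} {g : ℝ → ℂ}

lemma IsInterfaceOf.norm_apply_above_le (hA : IsInterfaceOf M r L A B B') (hr : 0 ≤ r)
    (hg : Continuous g) (hB : applyFun g B = 0) {ε : ℝ} (hε : 0 ≤ ε) {k : ℕ} {q : Polynomial ℂ}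
    (hq : q.natDegree ≤ k) (happrox : ∀ x : ℝ, |x| ≤ M → ‖g x - q.eval (x : ℂ)‖ ≤ ε)
    {ψ : Ell2 Lattice} (hψ : SupportedIn (above (L + k * r)) ψ) :
    ‖applyFun g A ψ‖ ≤ 2 * ε * ‖ψ‖ :=
  norm_applyFun_apply_le_of_agree hr hε hA.sa hA.sa_above hA.norm_le hA.norm_above_le
    hA.range_above hg hB hA.agree_above hψ (thick_above_subset le_rfl) hq happrox

lemma IsInterfaceOf.norm_apply_below_le (hA : IsInterfaceOf M r L A B B') (hr : 0 ≤ r)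
    (hg : Continuous g) (hB : applyFun g B' = 0) {ε : ℝ} (hε : 0 ≤ ε) {k : ℕ} {q : Polynomial ℂ}
    (hq : q.natDegree ≤ k) (happrox : ∀ x : ℝ, |x| ≤ M → ‖g x - q.eval (x : ℂ)‖ ≤ ε)
    {ψ : Ell2 Lattice} (hψ : SupportedIn (below (L + k * r)) ψ) :
    ‖applyFun g A ψ‖ ≤ 2 * ε * ‖ψ‖ :=
  norm_applyFun_apply_le_of_agree hr hε hA.sa hA.sa_below hA.norm_le hA.norm_below_le
    hA.range_below hg hB hA.agree_below hψ (thick_below_subset le_rfl) hq happrox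

/-- Although `g` is complex valued, `g(A)` is normal; this turns estimates on columns into estimates
on rows. -/
lemma norm_adjoint_applyFun_apply (g : ℝ → ℂ) (A : Op) (ψ : Ell2 Lattice) :
    ‖star (applyFun g A) ψ‖ = ‖applyFun g A ψ‖ :=
  (ContinuousLinearMap.isStarNormal_iff_norm_eq_adjoint.mp (isStarNormal_applyFun g A) ψ).symm

/-- A quantity bounded by `C₁ (k + 1)^{-p}` whenever `L + k r < D` is `O((1 + D)^{-p})`. -/
lemma le_div_one_add_pow {X C₀ C₁ D : ℝ} {p : ℕ} (hr : 1 ≤ r) (hL : 0 ≤ L) (hD : 0 ≤ D)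
    (hC₀ : 0 ≤ C₀) (hC₁ : 0 ≤ C₁) (h₀ : X ≤ C₀)
    (h₁ : ∀ k : ℕ, L + k * r < D → X ≤ C₁ / ((k : ℝ) + 1) ^ p) :
    X ≤ (C₀ + C₁) * (L + r + 1) ^ p / (1 + D) ^ p := by
  rw [le_div_iff₀ (by positivity)]
  -- For `D ≤ L` no `k` is admissible and the trivial bound `C₀` has to do.
  rcases le_or_gt D L with h | h
  · have h1 : 1 + D ≤ L + r + 1 := by linarith
    calc X * (1 + D) ^ p ≤ C₀ * (L + r + 1) ^ p := by gcongr
      _ ≤ (C₀ + C₁) * (L + r + 1) ^ p := by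
          gcongr
          linarith
  · have hr0 : 0 < r := by linarith
    -- The predecessor of this ceiling is the largest `k` with `L + k r < D`.
    have hpos : 0 < ⌈(D - L) / r⌉₊ := Nat.ceil_pos.mpr (div_pos (by linarith) hr0)
    obtain ⟨k, hk⟩ := Nat.exists_eq_succ_of_ne_zero hpos.ne'
    have h1 : (k : ℝ) < (D - L) / r := Nat.lt_ceil.mp (by omega)
    have h2 : (D - L) / r ≤ (k : ℝ) + 1 := by
      have := Nat.le_ceil ((D - L) / r)
      rw [hk] at this
      exact_mod_cast this
    rw [lt_div_iff₀ hr0] at h1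
    rw [div_le_iff₀ hr0] at h2
    have hk0 : (0 : ℝ) ≤ k := k.cast_nonneg
    -- By maximality `D ≤ L + (k + 1) r`, so `D` is controlled by a multiple of `k + 1`.
    have h3 : 1 + D ≤ ((k : ℝ) + 1) * (L + r + 1) := by nlinarith
    calc X * (1 + D) ^ p ≤ C₁ / ((k : ℝ) + 1) ^ p * (1 + D) ^ p := by
          gcongr
          exact h₁ k (by linarith)
      _ ≤ C₁ / ((k : ℝ) + 1) ^ p * (((k : ℝ) + 1) * (L + r + 1)) ^ p := by gcongr
      _ = C₁ * (L + r + 1) ^ p := by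
          rw [mul_pow]
          field_simp
      _ ≤ (C₀ + C₁) * (L + r + 1) ^ p := by
          gcongr
          linarith

lemma exists_bound_of_continuous (hg : Continuous g) (M : ℝ) :
    ∃ C : ℝ, 0 ≤ C ∧ ∀ x : ℝ, |x| ≤ M → ‖g x‖ ≤ C := by
  obtain ⟨C, hC⟩ := isCompact_Icc.exists_bound_of_continuousOn
    (s := Set.Icc (-M) M) hg.continuousOn
  exact ⟨|C|, abs_nonneg C, fun x hx => (hC x (abs_le.mp hx)).trans (le_abs_self C)⟩

/-- The decay of `g(A)` away from the interface and from the diagonal. -/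
lemma exists_decay (hg : ContDiff ℝ (⊤ : ℕ∞) g) (hM : 0 < M) (hr : 1 ≤ r) (hL : 0 ≤ L) (p : ℕ) :
    ∃ C : ℝ, 0 ≤ C ∧ ∀ A B B' : Op, IsInterfaceOf M r L A B B' → applyFun g B = 0 →
      applyFun g B' = 0 →
      (∀ m : Lattice, ‖applyFun g A (lp.single 2 m (1 : ℂ))‖ ≤ C / (1 + |(m.2 : ℝ)|) ^ p) ∧
      ∀ n m : Lattice,
        ‖matrixElement (applyFun g A) n m‖ ≤ C / (1 + |(n.1 : ℝ) - m.1|) ^ p := by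
  obtain ⟨C₁, hC₁, happ⟩ := exists_polynomial_approx hg hM p
  obtain ⟨C₀, hC₀, hbd⟩ := exists_bound_of_continuous hg.continuous M
  have hr0 : 0 ≤ r := by linarith
  refine ⟨(C₀ + 2 * C₁) * (L + r + 1) ^ p, by positivity, fun A B B' hA hB hB' => ⟨?_, ?_⟩⟩
  · intro m
    refine le_div_one_add_pow hr hL (abs_nonneg _) hC₀ (by positivity)
      ((norm_apply_single_le _ m).trans (norm_applyFun_le hA.norm_le hC₀ hbd)) fun k hk => ?_
    obtain ⟨q, hq, hqk⟩ := happ k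
    have hε : 0 ≤ C₁ / ((k : ℝ) + 1) ^ p := by positivity
    rw [mul_div_assoc]
    rcases lt_abs.mp hk with h | h
    · simpa [norm_single_one] using hA.norm_apply_above_le hr0 hg.continuous hB hε hq hqk
        ((supportedIn_single m).mono (Set.singleton_subset_iff.mpr h))
    · simpa [norm_single_one] using hA.norm_apply_below_le hr0 hg.continuous hB' hε hq hqk
        ((supportedIn_single m).mono (Set.singleton_subset_iff.mpr (lt_neg_of_lt_neg h)))
  · intro n m
    refine le_div_one_add_pow hr hL (abs_nonneg _) hC₀ (by positivity)
      ((norm_matrixElement_le _ n m).trans (norm_applyFun_le hA.norm_le hC₀ hbd)) fun k hk => ?_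
    obtain ⟨q, hq, hqk⟩ := happ k
    have hε : 0 ≤ C₁ / ((k : ℝ) + 1) ^ p := by positivity
    -- Beyond its range `k r` the polynomial contributes nothing, so only the error `g(A) - q(A)` is
    -- left.
    have h0 := hA.range.aeval hr0 hq n m
      (lt_of_lt_of_le (by linarith) (abs_fst_sub_le_dist n m))
    have h1 := (norm_matrixElement_le _ n m).trans
      (norm_applyFun_sub_aeval_le hg.continuous hA.sa hA.norm_le hε hqk)
    rw [matrixElement_sub, h0, sub_zero] at h1
    rw [mul_div_assoc]
    linarith

/-- Each of the four terms of the denominator, multiplied by the matrix element, is at most `C`;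
hence `4 C`. -/
lemma hasDecay_of_pow {A : Op} {α C : ℝ} (hα : 0 < α) (hC : 0 ≤ C)
    (h₁ : ∀ n m : Lattice, ‖matrixElement A n m‖ ≤ C / (1 + |(n.2 : ℝ)|) ^ ⌈α⌉₊)
    (h₂ : ∀ n m : Lattice, ‖matrixElement A n m‖ ≤ C / (1 + |(m.2 : ℝ)|) ^ ⌈α⌉₊)
    (h₃ : ∀ n m : Lattice, ‖matrixElement A n m‖ ≤ C / (1 + |(n.1 : ℝ) - m.1|) ^ ⌈α⌉₊) :
    HasDecay α (4 * C) A := by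
  have key : ∀ x a : ℝ, 0 ≤ x → 0 ≤ a → x ≤ C / (1 + a) ^ ⌈α⌉₊ → x * a ^ α ≤ C := by
    intro x a hx ha h
    rw [le_div_iff₀ (by positivity)] at h
    refine le_trans ?_ h
    gcongr
    calc a ^ α ≤ (1 + a) ^ α := by
          gcongr
          linarith
      _ ≤ (1 + a) ^ (⌈α⌉₊ : ℝ) := Real.rpow_le_rpow_of_exponent_le (by linarith) (Nat.le_ceil α)
      _ = _ := Real.rpow_natCast _ _
  intro n m
  have hx := norm_nonneg (matrixElement A n m)
  have e1 := key _ _ hx (abs_nonneg _) (h₁ n m)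
  have e2 := key _ _ hx (abs_nonneg _) (h₂ n m)
  have e3 := key _ _ hx (abs_nonneg _) (h₃ n m)
  have e0 : ‖matrixElement A n m‖ ≤ C := (h₁ n m).trans
    (div_le_self hC (one_le_pow₀ (by linarith [abs_nonneg (n.2 : ℝ)])))
  rw [le_div_iff₀ (by positivity)]
  linarith

/-- The decay of the matrix elements of `g(A)`, uniformly in the interface operator. -/
lemma exists_hasDecay (hg : ContDiff ℝ (⊤ : ℕ∞) g) (hM : 0 < M) (hr : 1 ≤ r) (hL : 0 ≤ L)
    {α : ℝ} (hα : 0 < α) :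
    ∃ C : ℝ, ∀ A B B' : Op, IsInterfaceOf M r L A B B' → applyFun g B = 0 →
      applyFun g B' = 0 → HasDecay α C (applyFun g A) := by
  obtain ⟨C, hC, h⟩ := exists_decay hg hM hr hL ⌈α⌉₊
  refine ⟨4 * C, fun A B B' hA hB hB' => ?_⟩
  obtain ⟨h1, h2⟩ := h A B B' hA hB hB'
  refine hasDecay_of_pow hα hC (fun n m => ?_)
    (fun n m => (norm_matrixElement_le_apply _ n m).trans (h1 m)) h2
  -- The row `n` of `g(A)` is the conjugate of a column of the adjoint, which by normality has the
  -- same norm as the column `n` of `g(A)`.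
  have e := norm_matrixElement_le_apply (star (applyFun g A)) m n
  rw [matrixElement_star, norm_star, norm_adjoint_applyFun_apply] at e
  exact e.trans (h1 n)

end Decay

/-! ### Norm approximation by strip-supported operators of finite range. -/

section Approximation

variable {M r L : ℝ} {A B B' : Op} {g : ℝ → ℂ}

/-- The strip `|n₂| ≤ c` around the interface. -/
def strip (c : ℝ) : Set Lattice := {n | |(n.2 : ℝ)| ≤ c}

lemma isStrip_strip (c : ℝ) : IsStrip (strip c) := by
  intro n
  simp [strip, unitVec]

lemma sub_proj_strip_apply {c : ℝ} (hc : 0 ≤ c) (ψ : Ell2 Lattice) :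
    ψ - proj (strip c) ψ = proj (above c) ψ + proj (below c) ψ := by
  classical
  ext n
  change ψ n - proj (strip c) ψ n = proj (above c) ψ n + proj (below c) ψ n
  rw [proj_apply, proj_apply, proj_apply]
  have h1 : n ∈ strip c ↔ -c ≤ n.2 ∧ (n.2 : ℝ) ≤ c := abs_le (a := (n.2 : ℝ))
  have h2 : n ∈ above c ↔ c < n.2 := Iff.rfl
  have h3 : n ∈ below c ↔ (n.2 : ℝ) < -c := Iff.rfl
  simp only [h1, h2, h3]
  rcases lt_or_ge c n.2 with h | h
  · have h' : ¬ (n.2 : ℝ) < -c := by linarith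
    simp [h, h', not_le.mpr h]
  · rcases lt_or_ge (n.2 : ℝ) (-c) with h' | h'
    · simp [h', not_le.mpr h', not_lt.mpr h]
    · simp [h, h', not_lt.mpr h, not_lt.mpr h']

/-- Here `9 = 4 + 4 + 1`: cutting `g(A)` off on the right costs `2 ε` from above and `2 ε` from
below the strip, cutting on the left costs the same by normality, and replacing `g(A)` by `q(A)`
between the cutoffs costs `ε`. -/
lemma IsInterfaceOf.norm_sub_proj_le (hA : IsInterfaceOf M r L A B B') (hr : 0 ≤ r) (hL : 0 ≤ L)
    (hg : Continuous g) (hB : applyFun g B = 0) (hB' : applyFun g B' = 0) {ε : ℝ} (hε : 0 ≤ ε)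
    {k : ℕ} {q : Polynomial ℂ} (hq : q.natDegree ≤ k)
    (happrox : ∀ x : ℝ, |x| ≤ M → ‖g x - q.eval (x : ℂ)‖ ≤ ε) :
    ‖applyFun g A - proj (strip (L + k * r)) * Polynomial.aeval A q * proj (strip (L + k * r))‖
      ≤ 9 * ε := by
  set c := L + k * r
  have hc : 0 ≤ c := by positivity
  set χ := proj (strip c)
  set G := applyFun g A
  set Q := Polynomial.aeval A q
  have hvec : ∀ ψ, ‖G (ψ - χ ψ)‖ ≤ 4 * ε * ‖ψ‖ := by
    intro ψ
    rw [sub_proj_strip_apply hc, map_add]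
    have h1 := hA.norm_apply_above_le hr hg hB hε hq happrox (supportedIn_proj (above c) ψ)
    have h2 := hA.norm_apply_below_le hr hg hB' hε hq happrox (supportedIn_proj (below c) ψ)
    have h3 := mul_le_mul_of_nonneg_left (norm_proj_apply_le (above c) ψ)
      (by positivity : 0 ≤ 2 * ε)
    have h4 := mul_le_mul_of_nonneg_left (norm_proj_apply_le (below c) ψ)
      (by positivity : 0 ≤ 2 * ε)
    refine (norm_add_le _ _).trans ?_
    linarith
  have hright : ‖G - G * χ‖ ≤ 4 * ε := by
    refine ContinuousLinearMap.opNorm_le_bound _ (by positivity) fun ψ => ?_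
    have e : (G - G * χ) ψ = G (ψ - χ ψ) := (map_sub G _ _).symm
    rw [e]
    exact hvec ψ
  have hleft : ‖G - χ * G‖ ≤ 4 * ε := by
    rw [← norm_star, star_sub, star_mul, star_proj]
    refine ContinuousLinearMap.opNorm_le_bound _ (by positivity) fun ψ => ?_
    have e : (star G - star G * χ) ψ = star G (ψ - χ ψ) := (map_sub (star G) _ _).symm
    rw [e, norm_adjoint_applyFun_apply]
    exact hvec ψ
  have hmid : ‖G - Q‖ ≤ ε := norm_applyFun_sub_aeval_le hg hA.sa hA.norm_le hε happrox
  have hχ : ‖χ‖ ≤ 1 := norm_proj_le _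
  have e : G - χ * Q * χ = (G - χ * G) + χ * (G - G * χ) + χ * (G - Q) * χ := by noncomm_ring
  rw [e]
  have h2 : ‖χ * (G - G * χ)‖ ≤ 4 * ε := by
    calc _ ≤ ‖χ‖ * ‖G - G * χ‖ := norm_mul_le _ _
      _ ≤ 1 * (4 * ε) := by gcongr
      _ = 4 * ε := one_mul _
  have h3 := (norm_proj_mul_proj_le (G - Q) (strip c)).trans hmid
  refine norm_add₃_le.trans ?_
  linarith

variable {Ω : Type*} [AddAction (ℤ × ℤ) Ω] [MeasurableSpace Ω]

lemma isEdgeCore_proj_aeval {H : Ω → Op} {u : Phases} (hmeas : IsMeasurableFamily H)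
    (hcov : IsCovariant u 0 H) (hr : 0 ≤ r) (hL : 0 ≤ L) (hrange : ∀ ω, HasRange r (H ω))
    (hsa : ∀ ω, IsSelfAdjoint (H ω)) (hM : ∀ ω, ‖H ω‖ ≤ M) {q : Polynomial ℂ} {k : ℕ}
    (hq : q.natDegree ≤ k) :
    IsEdgeCore u fun ω =>
      proj (strip (L + k * r)) * Polynomial.aeval (H ω) q * proj (strip (L + k * r)) where
  measurable := ((isMeasurableFamily_const _).mul (hmeas.aeval q)).mul (isMeasurableFamily_const _)
  bounded := by
    obtain ⟨C, hC, hbd⟩ := exists_bound_of_continuous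
      (g := fun x : ℝ => q.eval (x : ℂ)) (by fun_prop) M
    refine ⟨C, fun ω => (norm_proj_mul_proj_le _ _).trans ?_⟩
    -- With `f = 0` the approximation estimate becomes a bound on `q(H_ω)` itself.
    have h := norm_applyFun_sub_aeval_le (f := fun _ => 0) continuous_const (hsa ω) (hM ω) hC
      (q := q) (fun x hx => by simpa using hbd x hx)
    have h0 : applyFun (fun _ => 0) (H ω) = 0 := cfc_const_zero ℂ (H ω)
    simpa [h0] using h
  covariant := ((isCovariant_proj (isStrip_strip _) u).mul (hcov.aeval q)).mul
    (isCovariant_proj (isStrip_strip _) u)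
  support := by
    set c := L + k * r
    -- The least integer strictly above `c`, since strip and range include their boundary; `c ≥ k r`
    -- also covers the hopping distance.
    refine ⟨⌊c⌋ + 1, fun ω n m h => ?_⟩
    have hfloor : ∀ a : ℤ, ⌊c⌋ + 1 ≤ |a| → c < |(a : ℝ)| := fun a ha => by
      have h1 := Int.lt_floor_add_one c
      have h2 : ((⌊c⌋ + 1 : ℤ) : ℝ) ≤ ((|a| : ℤ) : ℝ) := by exact_mod_cast ha
      push_cast at h2
      linarith
    rcases h with h | h | h
    · exact matrixElement_proj_mul_proj _ _ n m (Or.inl (not_le.mpr (hfloor _ h)))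
    · exact matrixElement_proj_mul_proj _ _ n m (Or.inr (not_le.mpr (hfloor _ h)))
    · refine ((hrange ω).aeval hr hq).proj_mul_proj _ n m ?_
      have h1 := hfloor _ h
      push_cast at h1
      exact lt_of_lt_of_le (by linarith [show c = L + k * r from rfl]) (abs_fst_sub_le_dist n m)

end Approximation

/-! ### Traces and the trace class property. -/

section Trace

lemma summable_div_one_add_abs_sq (C : ℝ) :
    Summable fun k : ℤ => C / (1 + |(k : ℝ)|) ^ 2 := by
  have h : Summable fun k : ℤ => |C| * (1 / (k : ℝ) ^ 2) :=
    ((Real.summable_one_div_int_pow (p := 2)).mpr (by norm_num)).mul_left _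
  refine h.of_norm_bounded_eventually ?_
  filter_upwards [(Set.finite_singleton (0 : ℤ)).compl_mem_cofinite] with k hk
  have hk' : 0 < |(k : ℝ)| := by
    have : k ≠ 0 := hk
    positivity
  rw [norm_div, Real.norm_eq_abs, norm_pow, Real.norm_of_nonneg (by positivity), ← sq_abs (k : ℝ),
    mul_one_div]
  gcongr
  linarith

lemma exists_hasInterfaceTrace {Ω : Type*} [MeasurableSpace Ω] {P : Measure Ω} [IsFiniteMeasure P]
    {A : Ω → Op} (hA : IsMeasurableFamily A) {C : ℝ}
    (h : ∀ᵐ ω ∂P, ∀ k : ℤ, ‖matrixElement (A ω) (0, k) (0, k)‖ ≤ C / (1 + |(k : ℝ)|) ^ 2) :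
    ∃ t : ℂ, HasInterfaceTrace P A t := by
  have hs := summable_div_one_add_abs_sq C
  have hsum : ∀ᵐ ω ∂P, Summable fun k : ℤ => matrixElement (A ω) (0, k) (0, k) := by
    filter_upwards [h] with ω hω
    exact hs.of_norm_bounded hω
  refine ⟨_, hsum, ?_, rfl⟩
  refine Integrable.of_bound (C := ∑' k : ℤ, C / (1 + |(k : ℝ)|) ^ 2) ?_ ?_
  · refine aestronglyMeasurable_of_tendsto_ae atTop
      (f := fun (s : Finset ℤ) ω => ∑ k ∈ s, matrixElement (A ω) (0, k) (0, k))
      (fun s => (Finset.measurable_fun_sum s fun k _ => hA _ _).aestronglyMeasurable) ?_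
    filter_upwards [hsum] with ω hω
    exact hω.hasSum
  · filter_upwards [h] with ω hω
    exact tsum_of_norm_bounded hs.hasSum hω

end Trace

/-- Smooth functions of interface Hamiltonians which vanish on the bulk Hamiltonians are trace
class. -/
lemma isInterfaceTraceClass_applyFun {Ω : Type*} [AddAction (ℤ × ℤ) Ω] [MeasurableSpace Ω]
    {P : Measure Ω} [IsFiniteMeasure P] {u : Phases} {H Hp Hm : Ω → Op} {M r L : ℝ} (hM : 0 < M)
    (hr : 1 ≤ r) (hL : 0 ≤ L) (hH : ∀ ω, IsInterfaceOf M r L (H ω) (Hp ω) (Hm ω))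
    (hmeas : IsMeasurableFamily H) (hcov : IsCovariant u 0 H) {g : ℝ → ℂ}
    (hg : ContDiff ℝ (⊤ : ℕ∞) g) (hp : ∀ᵐ ω ∂P, applyFun g (Hp ω) = 0)
    (hm : ∀ᵐ ω ∂P, applyFun g (Hm ω) = 0) :
    IsInterfaceTraceClass P u fun ω => applyFun g (H ω) := by
  have hsa : ∀ ω, IsSelfAdjoint (H ω) := fun ω => (hH ω).sa
  have hn : ∀ ω, ‖H ω‖ ≤ M := fun ω => (hH ω).norm_le
  have hr0 : 0 ≤ r := by linarith
  -- Quadratic decay of the columns suffices for a summable diagonal.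
  obtain ⟨C, hC, hdec⟩ := exists_decay hg hM hr hL 2
  have hcol : ∀ᵐ ω ∂P, ∀ k : ℤ,
      ‖applyFun g (H ω) (lp.single 2 (0, k) (1 : ℂ))‖ ≤ C / (1 + |(k : ℝ)|) ^ 2 := by
    filter_upwards [hp, hm] with ω h1 h2 k
    exact (hdec _ _ _ (hH ω) h1 h2).1 (0, k)
  refine ⟨⟨hmeas.applyFun hg.continuous hsa hn, ?_, hcov.applyFun hsa hg.continuous, ?_⟩, ?_, ?_⟩
  · obtain ⟨C₀, hC₀, hbd⟩ := exists_bound_of_continuous hg.continuous M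
    exact ⟨C₀, fun ω => norm_applyFun_le (hn ω) hC₀ hbd⟩
  · intro ε hε
    -- Any rate tending to zero would do here; `k ≥ 9 C₁ / ε` brings the error `9 C₁ / (k + 1)`
    -- below `ε`.
    obtain ⟨C₁, hC₁, happ⟩ := exists_polynomial_approx hg hM 1
    obtain ⟨k, hk⟩ := exists_nat_ge (9 * C₁ / ε)
    obtain ⟨q, hq, hqk⟩ := happ k
    refine ⟨_, isEdgeCore_proj_aeval hmeas hcov hr0 hL (fun ω => (hH ω).range) hsa hn hq, ?_⟩
    filter_upwards [hp, hm] with ω h1 h2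
    refine ((hH ω).norm_sub_proj_le hr0 hL hg.continuous h1 h2 (by positivity) hq hqk).trans ?_
    rw [pow_one, ← mul_div_assoc, div_le_iff₀ (by positivity)]
    rw [div_le_iff₀ hε] at hk
    linarith
  · have hmeas' : IsMeasurableFamily fun ω => opAbs (applyFun g (H ω)) := by
      -- As `|g(H)| = |g|(H)` and `|g|` is continuous, measurability follows as for `g`.
      simp_rw [fun ω => opAbs_applyFun hg.continuous (hsa ω)]
      exact hmeas.applyFun (Complex.continuous_ofReal.comp hg.continuous.norm) hsa hn
    refine exists_hasInterfaceTrace (C := C) hmeas' ?_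
    filter_upwards [hcol] with ω hω k
    refine (norm_matrixElement_le_apply _ _ _).trans ?_
    rw [norm_opAbs_apply]
    exact hω k
  · refine exists_hasInterfaceTrace (C := C) (hmeas.applyFun hg.continuous hsa hn) ?_
    filter_upwards [hcol] with ω hω k
    exact (norm_matrixElement_le_apply _ _ _).trans (hω k)

end Interface

end

/-! ### The proposition. -/

theorem proposition1
    {Ω : Type*} [TopologicalSpace Ω] [CompactSpace Ω] [MeasurableSpace Ω] [BorelSpace Ω]
    [AddAction (ℤ × ℤ) Ω] [ContinuousConstVAdd (ℤ × ℤ) Ω]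
    (P : Measure Ω) [IsProbabilityMeasure P] [ErgodicVAdd (ℤ × ℤ) Ω P]
    (Bp Bm : ℝ) (up um : Interface.Phases)
    (hup : Interface.IsMagneticGauge Bp up) (hum : Interface.IsMagneticGauge Bm um)
    (Hp Hm K : Ω → Interface.Op)
    (hHp : Interface.IsBulkFamily up Hp) (hHm : Interface.IsBulkFamily um Hm)
    (hK : Interface.IsCoupling (Interface.joinPhases up um) K)
    (Δ : Set ℝ) (EF : ℝ) (hgap : Interface.GapCondition P Hp Hm Δ EF)
    (g : ℝ → ℂ) (hg : ContDiff ℝ (⊤ : ℕ∞) g) (hgsupp : Function.support g ⊆ Δ) :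
    (∀ α : ℝ, 0 < α → ∃ C : ℝ,
      -- at every `ω` where `Δ` is a gap of both bulk operators
      (∀ ω, Interface.IsGap Δ (Hp ω) → Interface.IsGap Δ (Hm ω) →
        Interface.HasDecay α C
          (Interface.applyFun g (Interface.interfaceHamiltonian Hp Hm K ω))) ∧
      -- in particular almost surely
      (∀ᵐ ω ∂P, Interface.HasDecay α C
          (Interface.applyFun g (Interface.interfaceHamiltonian Hp Hm K ω))) ∧
      -- and everywhere, if the bulk families are continuous and `P` has full support
      ((∀ n m, Continuous fun ω => Interface.matrixElement (Hp ω) n m) →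
        (∀ n m, Continuous fun ω => Interface.matrixElement (Hm ω) n m) →
        P.IsOpenPosMeasure →
        ∀ ω, Interface.HasDecay α C
          (Interface.applyFun g (Interface.interfaceHamiltonian Hp Hm K ω)))) ∧
    Interface.IsInterfaceTraceClass P (Interface.joinPhases up um)
      (fun ω => Interface.applyFun g (Interface.interfaceHamiltonian Hp Hm K ω)) := by
  obtain ⟨M, r, L, hM, hr, hL, hH⟩ := Interface.exists_isInterfaceOf hHp hHm hK
  have hp : ∀ ω, Interface.IsGap Δ (Hp ω) → Interface.applyFun g (Hp ω) = 0 := fun ω =>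
    Interface.applyFun_eq_zero_of_isGap hgsupp (hHp.selfAdjoint ω)
  have hm : ∀ ω, Interface.IsGap Δ (Hm ω) → Interface.applyFun g (Hm ω) = 0 := fun ω =>
    Interface.applyFun_eq_zero_of_isGap hgsupp (hHm.selfAdjoint ω)
  have hp' : ∀ᵐ ω ∂P, Interface.applyFun g (Hp ω) = 0 := hgap.gap_plus.mono hp
  have hm' : ∀ᵐ ω ∂P, Interface.applyFun g (Hm ω) = 0 := hgap.gap_minus.mono hm
  refine ⟨fun α hα => ?_, Interface.isInterfaceTraceClass_applyFun hM hr hL hH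
    (Interface.isMeasurableFamily_interfaceHamiltonian hHp.measurable hHm.measurable hK.measurable)
    (Interface.isCovariant_interfaceHamiltonian (hHp.covariant 0) (hHm.covariant 0) hK.covariant)
    hg hp' hm'⟩
  obtain ⟨C, hC⟩ := Interface.exists_hasDecay hg hM hr hL hα
  refine ⟨C, fun ω h1 h2 => hC _ _ _ (hH ω) (hp ω h1) (hm ω h2), ?_, ?_⟩
  · filter_upwards [hp', hm'] with ω h1 h2
    exact hC _ _ _ (hH ω) h1 h2
  · intro hcp hcm hP ω
    exact hC _ _ _ (hH ω)
      (Interface.applyFun_eq_zero_of_ae hg.continuous (fun ω => (hH ω).range_above)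
        hHp.selfAdjoint (fun ω => (hH ω).norm_above_le) hcp hp' ω)
      (Interface.applyFun_eq_zero_of_ae hg.continuous (fun ω => (hH ω).range_below)
        hHm.selfAdjoint (fun ω => (hH ω).norm_below_le) hcm hm' ω)
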